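/- Conventions. On $\mathbb R^3$ let $\langle a,b\rangle_E=a_1b_1+a_2b_2+a_3b_3$, $\langle a,b\rangle_L=a_1b_1+a_2b_2-a_3b_3$, $a\times_E b=(a_2b_3-b_2a_3,\;a_3b_1-b_3a_1,\;a_1b_2-b_1a_2)$ and $a\times_L b=(a_2b_3-b_2a_3,\;a_3b_1-b_3a_1,\;-(a_1b_2-b_1a_2))$; write $\mathbb E^3=(\mathbb R^3,\langle\,,\rangle_E)$, $\mathbb L^3=(\mathbb R^3,\langle\,,\rangle_L)$. Manifolds, maps and metrics are smooth. For an oriented Riemannian (resp. Lorentzian) $2$-manifold, the Hodge operator on $1$-forms is given in a positively oriented orthonormal coframe by $*\omega^1=\omega^2,\ *\omega^2=-\omega^1$ (resp. $*\omega^1=\omega^2,\ *\omega^2=\omega^1$, where $\omega^1$ is spacelike and $\omega^2$ timelike). Consider immersions $x:M\to N$ of an oriented surface of one of the three kinds: (i) $N=\mathbb E^3$; (ii) $N=\mathbb L^3$, $x$ spacelike; (iii) $N=\mathbb L^3$, $x$ timelike; put $\times=\times_E$ in (i) and $\times=\times_L$ in (ii), (iii). For a positively oriented orthonormal tangent frame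 $e_1,e_2$ (in (iii): $e_1$ spacelike, $e_2$ timelike), the Gauss map is $n=e_1\times e_2$ in (i) and $n=-e_1\times e_2$ in (ii), (iii); the mean curvature is $\tfrac12\operatorname{tr}_{\mathrm I}\mathrm{II}$ with $\mathrm I=\langle dx,dx\rangle$ and $\mathrm{II}=-\langle dx,dn\rangle$. The symbol $\int\theta$ denotes any map $y:M\to\mathbb R^3$ with $dy=\theta$. Let $H\neq0$ be a real constant. (a) Let $M$ be a connected, oriented $2$-manifold and let $x:M\to N$ be an immersion of kind (i), (ii) or (iii) with constant mean curvature $H$ and Gauss map $n$. Then, with $*$ the Hodge operator of the induced metric, the $1$-form $n\times(*dn)$ has a primitive, and for a suitable choice of it $$x=-\frac1{2H}\Big\{n+\int n\times(*dn)\Big\}.\qquad(1)$$ (b) Conversely, let $M$ be a simply connected, oriented $2$-manifold with a metric $g$, and let $n:M\to\mathbb R^3$ be smooth, where either (i) $g$ is Riemannian and $\langle n,n\rangle_E=1$; (ii) $g$ is Riemannian and $\langle n,n\rangle_L=-1$; or (iii) $g$ is Lorentzian and $\langle n,n\rangle_L=1$. With $*$ the Hodge operator of $g$, suppose that $d{*}dn$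 is everywhere parallel to $n$ (i.e. its values are multiples of $n$) and that $\eta=dn+n\times(*dn)$ satisfies: $\eta_p\ne0$ for every $p\in M$ in cases (i), (ii); $\eta_p(v)\neq0$ for every $p\in M$ and every nonzero $v\in T_pM$ in case (iii). Then $n\times(*dn)$ has a primitive, and for every choice of the primitive, (1) defines (i) an immersion into $\mathbb E^3$, (ii) a spacelike immersion into $\mathbb L^3$, or (iii) a timelike immersion into $\mathbb L^3$, respectively, with constant mean curvature $H$ and Gauss map $n$; here the Gauss map refers to the given orientation of $M$ in cases (i), (ii), and to the given or the opposite orientation of $M$ in case (iii). -/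

import Mathlib

open scoped Manifold ContDiff Topology

noncomputable section

namespace Kenmotsu

/-- The space `ℝ³` underlying Euclidean 3-space `𝔼³` and Lorentzian 3-space `𝕃³`. -/
abbrev R3 : Type := Fin 3 → ℝ

/-- The model plane. -/
abbrev R2 : Type := EuclideanSpace ℝ (Fin 2)

/-- The three kinds of surfaces: surfaces in `𝔼³`, spacelike surfaces in `𝕃³`,
timelike surfaces in `𝕃³`. -/
inductive Kind
  | euclidean
  | spacelike
  | timelike

/-- The sign of the third coordinate in the scalar product of the ambient space. -/
def Kind.ambientSign : Kind → ℝ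
  | .euclidean => 1
  | .spacelike => -1
  | .timelike => -1

/-- The value `⟨n, n⟩` of a unit normal `n`. -/
def Kind.normalSign : Kind → ℝ
  | .euclidean => 1
  | .spacelike => -1
  | .timelike => 1

/-- The value `⟨e₂, e₂⟩` for an orthonormal tangent frame `e₁, e₂` with `⟨e₁, e₁⟩ = 1`. -/
def Kind.frameSign : Kind → ℝ
  | .euclidean => 1
  | .spacelike => 1
  | .timelike => -1

/-- The sign in `n = ± e₁ × e₂`, for `e₁, e₂` a positively oriented orthonormal tangent frame. -/
def Kind.gaussSign : Kind → ℝ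
  | .euclidean => 1
  | .spacelike => -1
  | .timelike => -1

/-- The scalar product `⟨a, b⟩ = a₁b₁ + a₂b₂ ± a₃b₃` of the ambient space. -/
def Kind.form (K : Kind) : R3 →L[ℝ] R3 →L[ℝ] ℝ :=
  (ContinuousLinearMap.proj (R := ℝ) (φ := fun _ : Fin 3 => ℝ) 0).smulRight
      (ContinuousLinearMap.proj (R := ℝ) (φ := fun _ : Fin 3 => ℝ) 0)
    + (ContinuousLinearMap.proj (R := ℝ) (φ := fun _ : Fin 3 => ℝ) 1).smulRight
      (ContinuousLinearMap.proj (R := ℝ) (φ := fun _ : Fin 3 => ℝ) 1)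
    + K.ambientSign • (ContinuousLinearMap.proj (R := ℝ) (φ := fun _ : Fin 3 => ℝ) 2).smulRight
      (ContinuousLinearMap.proj (R := ℝ) (φ := fun _ : Fin 3 => ℝ) 2)

theorem Kind.form_apply (K : Kind) (a b : R3) :
    K.form a b = a 0 * b 0 + a 1 * b 1 + K.ambientSign * (a 2 * b 2) := by
  simp [Kind.form]

/-- The vector product `b ↦ a × b` of the ambient space (Euclidean or Lorentzian). -/
def Kind.cross (K : Kind) (a : R3) : R3 →L[ℝ] R3 :=
  LinearMap.toContinuousLinearMap
    { toFun := fun b => ![a 1 * b 2 - b 1 * a 2, a 2 * b 0 - b 2 * a 0,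
        K.ambientSign * (a 0 * b 1 - b 0 * a 1)]
      map_add' := by
        intro b c
        ext i
        fin_cases i <;> simp <;> ring
      map_smul' := by
        intro r b
        ext i
        fin_cases i <;> simp <;> ring }

/-! ### Bilinear forms on an oriented plane -/

section Plane

variable {T : Type*} [AddCommGroup T] [Module ℝ T] [TopologicalSpace T]
  [IsTopologicalAddGroup T] [ContinuousSMul ℝ T] [T2Space T]

/-- The bilinear form `g` is positive definite (first two kinds), or takes positive and negative
values (third kind; in dimension two, a symmetric form with this property has signature `(1,1)`). -/
def Kind.HasSignature (K : Kind) (g : T →L[ℝ] T →L[ℝ] ℝ) : Prop :=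
  match K with
  | .euclidean => ∀ v, v ≠ 0 → 0 < g v v
  | .spacelike => ∀ v, v ≠ 0 → 0 < g v v
  | .timelike => (∃ v, 0 < g v v) ∧ ∃ v, g v v < 0

variable [FiniteDimensional ℝ T] [Fact (Module.finrank ℝ T = 2)]

/-- A positively oriented basis. -/
def posBasis (o : Orientation ℝ T (Fin 2)) : Module.Basis (Fin 2) ℝ T :=
  o.someBasis (by rw [Fintype.card_fin]; exact (Fact.out : Module.finrank ℝ T = 2).symm)

/-- The volume form of the form `g` on the oriented plane `T`: it is
`√|det (g (b i) (b j))| · b⁰ ∧ b¹` for any positively oriented basis `b`. -/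
def volForm (g : T →L[ℝ] T →L[ℝ] ℝ) (o : Orientation ℝ T (Fin 2)) : T →L[ℝ] T →L[ℝ] ℝ :=
  let b := posBasis o
  let c : Fin 2 → (T →L[ℝ] ℝ) := fun i => LinearMap.toContinuousLinearMap (b.coord i)
  √|g (b 0) (b 0) * g (b 1) (b 1) - g (b 0) (b 1) * g (b 1) (b 0)| •
    ((c 0).smulRight (c 1) - (c 1).smulRight (c 0))

/-- The endomorphism `J` with `g (J v) w = vol v w`. -/
def rot (g : T →L[ℝ] T →L[ℝ] ℝ) (o : Orientation ℝ T (Fin 2)) : T →L[ℝ] T :=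
  g.inverse ∘L volForm g o

/-- The Hodge star of a vector-valued covector `α`. For a scalar covector `α = g a` it is
`*α = vol a`, i.e. `(*α) v = vol a v = - α (J v)`; in terms of a positively oriented
orthonormal coframe, `*ω¹ = ω²` and `*ω² = - ω¹` if `g` is positive definite,
`*ω¹ = ω²` and `*ω² = ω¹` if `g` has signature `(1,1)`, with `ω¹` spacelike. -/
def hodge {F : Type*} [AddCommGroup F] [Module ℝ F] [TopologicalSpace F]
    [IsTopologicalAddGroup F]
    (g : T →L[ℝ] T →L[ℝ] ℝ) (o : Orientation ℝ T (Fin 2)) (α : T →L[ℝ] F) : T →L[ℝ] F :=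
  -(α ∘L rot g o)

end Plane

/-! ### Surfaces -/

section Surface

variable {M : Type*} [TopologicalSpace M] [ChartedSpace R2 M]

instance (p : M) : T2Space (TangentSpace (𝓡 2) p) := inferInstanceAs (T2Space R2)

instance (p : M) : FiniteDimensional ℝ (TangentSpace (𝓡 2) p) :=
  inferInstanceAs (FiniteDimensional ℝ R2)

instance (p : M) : Fact (Module.finrank ℝ (TangentSpace (𝓡 2) p) = 2) :=
  ⟨show Module.finrank ℝ R2 = 2 by simp⟩

/-- A family of orientations of the tangent planes is an orientation of the surface `M`
if it is locally constant in the local trivializations of the tangent bundle. -/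
def IsOrientation [IsManifold (𝓡 2) ∞ M]
    (o : ∀ p : M, Orientation ℝ (TangentSpace (𝓡 2) p) (Fin 2)) : Prop :=
  ∀ p : M, ∃ o₀ : Orientation ℝ R2 (Fin 2), ∀ᶠ q in 𝓝 p,
    ∀ hq : q ∈ (trivializationAt R2 (TangentSpace (𝓡 2) : M → Type _) p).baseSet,
      Orientation.map (Fin 2)
        ((trivializationAt R2 (TangentSpace (𝓡 2) : M → Type _) p).continuousLinearEquivAt
          ℝ q hq).toLinearEquiv (o q) = o₀

/-- A smooth metric on `M`, Riemannian for the first two kinds and Lorentzian for the third. -/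
structure IsMetric [IsManifold (𝓡 2) ∞ M] (K : Kind)
    (g : ∀ p : M, TangentSpace (𝓡 2) p →L[ℝ] TangentSpace (𝓡 2) p →L[ℝ] ℝ) : Prop where
  symm : ∀ p v w, g p v w = g p w v
  signature : ∀ p, K.HasSignature (g p)
  contMDiff : ContMDiff (𝓡 2) ((𝓡 2).prod 𝓘(ℝ, R2 →L[ℝ] R2 →L[ℝ] ℝ)) ∞
    (fun p => Bundle.TotalSpace.mk' (R2 →L[ℝ] R2 →L[ℝ] ℝ)
      (E := fun q : M => TangentSpace (𝓡 2) q →L[ℝ] TangentSpace (𝓡 2) q →L[ℝ] ℝ) p (g p))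

/-- The bilinear form `(v, w) ↦ ⟨α v, β w⟩`. -/
def pairing {p : M} (K : Kind) (α β : TangentSpace (𝓡 2) p →L[ℝ] R3) :
    TangentSpace (𝓡 2) p →L[ℝ] TangentSpace (𝓡 2) p →L[ℝ] ℝ :=
  (ContinuousLinearMap.precomp ℝ β) ∘L K.form ∘L α

/-- The first fundamental form (induced metric) `⟨dx, dx⟩`. -/
def firstForm (K : Kind) (x : M → R3) (p : M) :
    TangentSpace (𝓡 2) p →L[ℝ] TangentSpace (𝓡 2) p →L[ℝ] ℝ :=
  pairing K (mvfderiv (𝓡 2) x p) (mvfderiv (𝓡 2) x p)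

/-- The second fundamental form `-⟨dx, dn⟩`. -/
def secondForm (K : Kind) (x n : M → R3) (p : M) :
    TangentSpace (𝓡 2) p →L[ℝ] TangentSpace (𝓡 2) p →L[ℝ] ℝ :=
  -pairing K (mvfderiv (𝓡 2) x p) (mvfderiv (𝓡 2) n p)

/-- The mean curvature: half the trace of the second fundamental form with respect to the first. -/
def meanCurvature (K : Kind) (x n : M → R3) (p : M) : ℝ :=
  (1 / 2) * LinearMap.trace ℝ (TangentSpace (𝓡 2) p)
    ((firstForm K x p).inverse ∘L secondForm K x n p).toLinearMap

/-- A smooth immersion of the given kind: into `𝔼³`, spacelike into `𝕃³` or timelike into `𝕃³`. -/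
structure IsImmersionOfKind (K : Kind) (x : M → R3) : Prop where
  contMDiff : ContMDiff (𝓡 2) 𝓘(ℝ, R3) ∞ x
  injective : ∀ p, Function.Injective (mvfderiv (𝓡 2) x p)
  signature : ∀ p, K.HasSignature (firstForm K x p)

/-- The Gauss map of an immersion `x` of the given kind, for the orientation `o` of `M`: the smooth
map with `n = ± e₁ × e₂` for positively oriented orthonormal tangent frames `e₁, e₂`. -/
structure IsGaussMap (K : Kind) (o : ∀ p : M, Orientation ℝ (TangentSpace (𝓡 2) p) (Fin 2))
    (x n : M → R3) : Prop where
  contMDiff : ContMDiff (𝓡 2) 𝓘(ℝ, R3) ∞ n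
  eq_cross : ∀ (p : M) (e : Module.Basis (Fin 2) ℝ (TangentSpace (𝓡 2) p)),
    e.orientation = o p →
    firstForm K x p (e 0) (e 0) = 1 →
    firstForm K x p (e 0) (e 1) = 0 →
    firstForm K x p (e 1) (e 1) = K.frameSign →
    n p = K.gaussSign • K.cross (mvfderiv (𝓡 2) x p (e 0)) (mvfderiv (𝓡 2) x p (e 1))

/-- `x` is an immersion of the given kind with Gauss map `n` and constant mean curvature `H`. -/
structure IsCMC (K : Kind) (o : ∀ p : M, Orientation ℝ (TangentSpace (𝓡 2) p) (Fin 2))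
    (H : ℝ) (x n : M → R3) : Prop where
  immersion : IsImmersionOfKind K x
  gaussMap : IsGaussMap K o x n
  meanCurvature_eq : ∀ p, meanCurvature K x n p = H

/-- The `ℝ³`-valued 1-form `*dn`. -/
def starD (g : ∀ p : M, TangentSpace (𝓡 2) p →L[ℝ] TangentSpace (𝓡 2) p →L[ℝ] ℝ)
    (o : ∀ p : M, Orientation ℝ (TangentSpace (𝓡 2) p) (Fin 2)) (n : M → R3) (p : M) :
    TangentSpace (𝓡 2) p →L[ℝ] R3 :=
  hodge (g p) (o p) (mvfderiv (𝓡 2) n p)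

/-- The `ℝ³`-valued 1-form `n × (*dn)`. -/
def crossStarD (K : Kind)
    (g : ∀ p : M, TangentSpace (𝓡 2) p →L[ℝ] TangentSpace (𝓡 2) p →L[ℝ] ℝ)
    (o : ∀ p : M, Orientation ℝ (TangentSpace (𝓡 2) p) (Fin 2)) (n : M → R3) (p : M) :
    TangentSpace (𝓡 2) p →L[ℝ] R3 :=
  K.cross (n p) ∘L starD g o n p

/-- The 1-form `θ` in the chart around `p`. -/
def chartForm (θ : ∀ q : M, TangentSpace (𝓡 2) q →L[ℝ] R3) (p : M) (y : R2) : R2 →L[ℝ] R3 :=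
  θ ((extChartAt (𝓡 2) p).symm y) ∘L
    mfderiv 𝓘(ℝ, R2) (𝓡 2) (extChartAt (𝓡 2) p).symm y

/-- The exterior derivative `dθ` of a 1-form, computed in the chart around `p`:
`dθ (v, w) = (D_v θ) w - (D_w θ) v`. The tangent plane at `p` is identified with the
model plane through that chart. -/
def extDerivOne (θ : ∀ q : M, TangentSpace (𝓡 2) q →L[ℝ] R3) (p : M)
    (v w : TangentSpace (𝓡 2) p) : R3 :=
  fderiv ℝ (chartForm θ p) (extChartAt (𝓡 2) p p) v w
    - fderiv ℝ (chartForm θ p) (extChartAt (𝓡 2) p p) w v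

/-- `y` is an indefinite integral `∫ θ` of the 1-form `θ`. -/
def IsPrimitive (θ : ∀ p : M, TangentSpace (𝓡 2) p →L[ℝ] R3) (y : M → R3) : Prop :=
  MDifferentiable (𝓡 2) 𝓘(ℝ, R3) y ∧ ∀ p, mvfderiv (𝓡 2) y p = θ p

/-- The condition `dn + n × *dn ≠ 0` on the 1-form `η = dn + n × *dn`. For the first two kinds it
says that `η` vanishes at no point; for timelike surfaces, that `η` annihilates
no nonzero tangent vector. -/
def Kind.Nonvanishing (K : Kind) (η : ∀ p : M, TangentSpace (𝓡 2) p →L[ℝ] R3) : Prop :=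
  match K with
  | .euclidean => ∀ p, η p ≠ 0
  | .spacelike => ∀ p, η p ≠ 0
  | .timelike => ∀ (p : M) (v : TangentSpace (𝓡 2) p), v ≠ 0 → η p v ≠ 0

end Surface

end Kenmotsu

end

/-!
For an immersion `x` with Gauss map `n`, the covector `dx` intertwines the (para)complex structure
`J` of the induced metric with `± n ×`, and so does `η = dn + n × *dn`. Both are determined by their
value on one frame vector. Symmetry of the second fundamental form and the definition of the mean
curvature then give `η = -2H dx`, which for constant `H` integrates to the representation formula.

Conversely, `d(n × *dn) = dn × *dn + n × d*dn = n × d*dn`, because `dn × *dn` is symmetric in its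
arguments, so `n × *dn` is closed when `d*dn` is parallel to `n`. The intertwining property makes
`η` conformal, and `x = -(1/2H) ∫ η` therefore has first fundamental form `k g`. The structure `J`,
and with it the Hodge star, is unchanged when passing from `g` to `k g`, provided the orientation is
reversed where `k < 0`; thus `η = -2H dx` is also the form `dn + n × *dn` of the induced metric, and
`n` and `H` are the Gauss map and the mean curvature of `x`. A negative `k` occurs only for timelike
surfaces, and there `k` has constant sign on a connected surface.
-/

namespace Kenmotsu

namespace Kind

variable (K : Kind)

theorem ambientSign_mul_self : K.ambientSign * K.ambientSign = 1 := by
  cases K <;> simp [ambientSign]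

theorem frameSign_mul_self : K.frameSign * K.frameSign = 1 := by
  cases K <;> simp [frameSign]

theorem frameSign_ne_zero : K.frameSign ≠ 0 :=
  left_ne_zero_of_mul_eq_one K.frameSign_mul_self

theorem gaussSign_eq_ambientSign : K.gaussSign = K.ambientSign := by
  cases K <;> rfl

theorem ambientSign_mul_normalSign : K.ambientSign * K.normalSign = K.frameSign := by
  cases K <;> simp [normalSign, ambientSign, frameSign]

theorem form_comm (a b : R3) : K.form a b = K.form b a := by
  simp only [form_apply]; ring

theorem cross_apply (a b : R3) :
    K.cross a b = ![a 1 * b 2 - b 1 * a 2, a 2 * b 0 - b 2 * a 0,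
      K.ambientSign * (a 0 * b 1 - b 0 * a 1)] := rfl

/-- The vector product of the ambient space as a continuous bilinear map. -/
noncomputable def crossL : R3 →L[ℝ] R3 →L[ℝ] R3 :=
  LinearMap.toContinuousLinearMap
    { toFun := K.cross
      map_add' := fun a b => by ext c i; fin_cases i <;> simp [cross_apply] <;> ring
      map_smul' := fun r a => by ext c i; fin_cases i <;> simp [cross_apply] <;> ring }

theorem crossL_apply (a : R3) : K.crossL a = K.cross a := rfl

theorem cross_anticomm (a b : R3) : K.cross a b = -K.cross b a := by
  ext i
  fin_cases i <;> simp only [cross_apply, Matrix.cons_val, Pi.neg_apply, Fin.zero_eta, Fin.mk_one,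
    Fin.reduceFinMk] <;> ring

theorem cross_self (a : R3) : K.cross a a = 0 :=
  self_eq_neg.1 (K.cross_anticomm a a)

theorem form_self_cross (a b : R3) : K.form a (K.cross a b) = 0 := by
  simp only [form_apply, cross_apply, Matrix.cons_val]
  linear_combination (a 2 * (a 0 * b 1 - b 0 * a 1)) * K.ambientSign_mul_self

theorem form_cross_left (a b c : R3) : K.form (K.cross a b) c = -K.form b (K.cross a c) := by
  simp only [form_apply, cross_apply, Matrix.cons_val]
  linear_combination (c 2 * (a 0 * b 1 - b 0 * a 1) + b 2 * (a 0 * c 1 - c 0 * a 1)) *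
    K.ambientSign_mul_self

theorem cross_cross (a b c : R3) :
    K.cross a (K.cross b c) = K.ambientSign • (K.form a c • b - K.form a b • c) := by
  ext i
  fin_cases i <;>
    simp only [cross_apply, form_apply, Matrix.cons_val, Pi.smul_apply, Pi.sub_apply, smul_eq_mul,
      Fin.zero_eta, Fin.mk_one, Fin.reduceFinMk]
  · linear_combination (a 2 * (b 2 * c 0 - c 2 * b 0)) * K.ambientSign_mul_self
  · linear_combination (a 2 * (b 2 * c 1 - b 1 * c 2)) * K.ambientSign_mul_self
  · ring

theorem cross_ne_zero {a b : R3} (h : LinearIndependent ℝ ![a, b]) : K.cross a b ≠ 0 := by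
  have hδ : K.ambientSign ≠ 0 := left_ne_zero_of_mul_eq_one K.ambientSign_mul_self
  refine fun h0 => crossProduct_ne_zero_iff_linearIndependent.2 h ?_
  ext i
  have hi := congrFun h0 i
  fin_cases i <;>
    simp_all [cross_apply, _root_.cross_apply, mul_comm]

variable {K} {n : R3}

theorem cross_cross_of_orthogonal (hn : K.form n n = K.normalSign) {v : R3} (hv : K.form n v = 0) :
    K.cross n (K.cross n v) = -(K.frameSign • v) := by
  rw [cross_cross, hv, hn, zero_smul, zero_sub, smul_neg, smul_smul, ambientSign_mul_normalSign]

theorem eq_zero_of_orthogonal (hn : K.form n n = K.normalSign) {γ : ℝ} {a b z : R3}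
    (hab : n = γ • K.cross a b) (hzn : K.form n z = 0) (hza : K.form z a = 0)
    (hzb : K.form z b = 0) : z = 0 := by
  have hcross : K.cross n z = 0 := by
    rw [cross_anticomm, hab, map_smul, cross_cross, hza, hzb, zero_smul, zero_smul, sub_zero,
      smul_zero, smul_zero, neg_zero]
  have h := cross_cross_of_orthogonal hn hzn
  rw [hcross, map_zero, eq_comm, neg_eq_zero] at h
  exact (smul_eq_zero.1 h).resolve_left K.frameSign_ne_zero

theorem form_self_pos_of_orthogonal (hK : K ≠ .timelike) (hn : K.form n n = K.normalSign) {v : R3}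
    (hv : K.form n v = 0) (hv0 : v ≠ 0) : 0 < K.form v v := by
  cases K with
  | timelike => exact absurd rfl hK
  | euclidean =>
    obtain ⟨i, hi⟩ := Function.ne_iff.1 hv0
    have hsum : Kind.euclidean.form v v = ∑ i, v i * v i := by
      simp only [form_apply, ambientSign, one_mul, Fin.sum_univ_three]
    exact hsum ▸ Finset.sum_pos' (fun i _ => mul_self_nonneg (v i))
      ⟨i, Finset.mem_univ i, mul_self_pos.2 hi⟩
  | spacelike =>
    simp only [form_apply, ambientSign, normalSign] at hn hv ⊢
    have hn2 : 0 < n 2 ^ 2 := by linarith [mul_self_nonneg (n 0), mul_self_nonneg (n 1)]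
    have hv01 : v 0 ≠ 0 ∨ v 1 ≠ 0 := by
      by_contra! h
      have h2 : v 2 = 0 := by simpa [h, ne_zero_pow two_ne_zero hn2.ne'] using hv
      exact hv0 (by ext i; fin_cases i; exacts [h.1, h.2, h2])
    have hsum : n 2 ^ 2 * (v 0 * v 0 + v 1 * v 1 + -1 * (v 2 * v 2)) =
        v 0 ^ 2 + v 1 ^ 2 + (n 0 * v 1 - n 1 * v 0) ^ 2 := by
      linear_combination (n 0 * v 0 + n 1 * v 1 + n 2 * v 2) * hv - (v 0 ^ 2 + v 1 ^ 2) * hn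
    refine pos_of_mul_pos_right (hsum ▸ ?_) hn2.le
    rcases hv01 with h | h <;> positivity

end Kind

section Plane

variable {T : Type*} [AddCommGroup T] [Module ℝ T]

theorem basis_sum_repr (b : Module.Basis (Fin 2) ℝ T) (v : T) :
    b.repr v 0 • b 0 + b.repr v 1 • b 1 = v :=
  Fin.sum_univ_two (fun i => b.repr v i • b i) ▸ b.sum_repr v

theorem basis_det_apply (b : Module.Basis (Fin 2) ℝ T) (f : Fin 2 → T) :
    b.det f = b.repr (f 0) 0 * b.repr (f 1) 1 - b.repr (f 0) 1 * b.repr (f 1) 0 := by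
  simp only [Module.Basis.det_apply, Matrix.det_fin_two, Module.Basis.toMatrix_apply]
  ring

variable [TopologicalSpace T]

theorem clm_ext_basis {F : Type*} [AddCommGroup F] [Module ℝ F] [TopologicalSpace F]
    (b : Module.Basis (Fin 2) ℝ T) {α β : T →L[ℝ] F} (h0 : α (b 0) = β (b 0))
    (h1 : α (b 1) = β (b 1)) : α = β :=
  ContinuousLinearMap.coe_injective (b.ext (Fin.forall_fin_two.2 ⟨h0, h1⟩))

/-- The Gram determinant of a bilinear form on a pair of vectors. -/
noncomputable def gramDet (g : T →L[ℝ] T →L[ℝ] ℝ) (f : Fin 2 → T) : ℝ :=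
  g (f 0) (f 0) * g (f 1) (f 1) - g (f 0) (f 1) * g (f 1) (f 0)

theorem gramDet_eq_det_sq_mul (g : T →L[ℝ] T →L[ℝ] ℝ) (b : Module.Basis (Fin 2) ℝ T)
    (f : Fin 2 → T) : gramDet g f = b.det f ^ 2 * gramDet g b := by
  have hexpand (v w : T) : g v w =
      b.repr v 0 * (b.repr w 0 * g (b 0) (b 0) + b.repr w 1 * g (b 0) (b 1))
        + b.repr v 1 * (b.repr w 0 * g (b 1) (b 0) + b.repr w 1 * g (b 1) (b 1)) := by
    conv_lhs => rw [← basis_sum_repr b v, ← basis_sum_repr b w]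
    simp only [map_add, map_smul, add_apply, smul_apply, smul_eq_mul]
    ring
  simp only [gramDet, basis_det_apply, hexpand (f _) (f _)]
  ring

theorem gramDet_smul (k : ℝ) (g : T →L[ℝ] T →L[ℝ] ℝ) (f : Fin 2 → T) :
    gramDet (k • g) f = k ^ 2 * gramDet g f := by
  simp only [gramDet, smul_apply, smul_eq_mul]
  ring

/-- The bilinear form `(v, w) ↦ g (f v) (f w)`. -/
noncomputable def pullback {T' : Type*} [AddCommGroup T'] [Module ℝ T'] [TopologicalSpace T']
    (g : T' →L[ℝ] T' →L[ℝ] ℝ) (f : T →L[ℝ] T') :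
    T →L[ℝ] T →L[ℝ] ℝ :=
  (ContinuousLinearMap.precomp ℝ f) ∘L g ∘L f

theorem pullback_smul {T' : Type*} [AddCommGroup T'] [Module ℝ T'] [TopologicalSpace T']
    [ContinuousConstSMul ℝ T'] (g : T' →L[ℝ] T' →L[ℝ] ℝ) (r : ℝ) (f : T →L[ℝ] T') :
    pullback g (r • f) = r ^ 2 • pullback g f := by
  ext v w
  simp [pullback, sq, mul_assoc]

variable [IsTopologicalAddGroup T] [ContinuousSMul ℝ T] [T2Space T] [FiniteDimensional ℝ T]

theorem isInvertible_of_gramDet_ne_zero {g : T →L[ℝ] T →L[ℝ] ℝ} {b : Module.Basis (Fin 2) ℝ T}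
    (hg : gramDet g b ≠ 0) : g.IsInvertible := by
  have hinj : Function.Injective g.toLinearMap := by
    refine (injective_iff_map_eq_zero _).2 fun v hv => ?_
    have hker (w : T) :
        b.repr v 0 * g (b 0) w + b.repr v 1 * g (b 1) w = 0 := by
      have hvw : g (b.repr v 0 • b 0 + b.repr v 1 • b 1) w = 0 :=
        (basis_sum_repr b v).symm ▸ DFunLike.congr_fun hv w
      simpa only [map_add, map_smul, add_apply, smul_apply, smul_eq_mul] using hvw
    have h0 : b.repr v 0 * gramDet g b = 0 := by
      unfold gramDet
      linear_combination g (b 1) (b 1) * hker (b 0) - g (b 1) (b 0) * hker (b 1)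
    have h1 : b.repr v 1 * gramDet g b = 0 := by
      unfold gramDet
      linear_combination g (b 0) (b 0) * hker (b 1) - g (b 0) (b 1) * hker (b 0)
    rw [← basis_sum_repr b v, (mul_eq_zero.1 h0).resolve_right hg,
      (mul_eq_zero.1 h1).resolve_right hg, zero_smul, zero_smul, add_zero]
  have hdim : Module.finrank ℝ T = Module.finrank ℝ (T →L[ℝ] ℝ) :=
    (Subspace.dual_finrank_eq (K := ℝ) (V := T)).symm.trans
      (LinearMap.toContinuousLinearMap (𝕜 := ℝ) (E := T) (F' := ℝ)).finrank_eq
  have : FiniteDimensional ℝ (T →L[ℝ] ℝ) :=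
    (LinearMap.toContinuousLinearMap (𝕜 := ℝ) (E := T) (F' := ℝ)).finiteDimensional
  exact ⟨(LinearMap.linearEquivOfInjective g.toLinearMap hinj hdim).toContinuousLinearEquiv,
    ContinuousLinearMap.ext fun _ => rfl⟩

variable [Fact (Module.finrank ℝ T = 2)]

theorem volForm_apply (g : T →L[ℝ] T →L[ℝ] ℝ) {o : Orientation ℝ T (Fin 2)}
    {b : Module.Basis (Fin 2) ℝ T} (hb : b.orientation = o) (v w : T) :
    volForm g o v w = √|gramDet g b| * b.det ![v, w] := by
  set c := posBasis o with hc
  have hpos : 0 < c.det b := by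
    rw [← Module.Basis.orientation_eq_iff_det_pos, hb]
    exact Orientation.someBasis_orientation _ _
  have hdet : c.det ![v, w] = c.det b * b.det ![v, w] :=
    congrArg (· ![v, w]) (c.det.eq_smul_basis_det b)
  have hvol : volForm g o v w = √|gramDet g c| * c.det ![v, w] := by
    simp [volForm, gramDet, ← hc, basis_det_apply]
  rw [hvol, hdet, gramDet_eq_det_sq_mul g c b, abs_mul, abs_sq, Real.sqrt_mul (sq_nonneg _),
    Real.sqrt_sq hpos.le]
  ring

theorem volForm_neg (g : T →L[ℝ] T →L[ℝ] ℝ) (o : Orientation ℝ T (Fin 2)) :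
    volForm g (-o) = -volForm g o := by
  set b := posBasis o
  have hb : b.orientation = o := Orientation.someBasis_orientation _ _
  set c := b.unitsSMul (Function.update 1 1 (-1)) with hc
  have hc' : c.orientation = -o := by rw [hc, Module.Basis.orientation_neg_single, hb]
  have hdet : c.det = -b.det := by
    ext f
    simp [hc, Module.Basis.det_unitsSMul]
  have hgram : gramDet g c = gramDet g b := by
    simp [gramDet, hc, Module.Basis.unitsSMul_apply]
  ext v w
  rw [neg_apply, neg_apply, volForm_apply g hc', volForm_apply g hb, hdet, hgram]
  exact mul_neg _ _

theorem volForm_smul (k : ℝ) (g : T →L[ℝ] T →L[ℝ] ℝ) (o : Orientation ℝ T (Fin 2)) :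
    volForm (k • g) o = |k| • volForm g o := by
  have hb : (posBasis o).orientation = o := Orientation.someBasis_orientation _ _
  ext v w
  rw [smul_apply, smul_apply, volForm_apply _ hb, volForm_apply _ hb, gramDet_smul, abs_mul,
    abs_sq, Real.sqrt_mul (sq_nonneg _), Real.sqrt_sq_eq_abs, smul_eq_mul, mul_assoc]

theorem rot_neg (g : T →L[ℝ] T →L[ℝ] ℝ) (o : Orientation ℝ T (Fin 2)) : rot g (-o) = -rot g o := by
  rw [rot, rot, volForm_neg, ContinuousLinearMap.comp_neg]

theorem rot_smul {g : T →L[ℝ] T →L[ℝ] ℝ} (hg : g.IsInvertible) {k : ℝ} (hk : k ≠ 0)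
    (o : Orientation ℝ T (Fin 2)) : rot (k • g) o = (k⁻¹ * |k|) • rot g o := by
  have hkg : (k • g).IsInvertible := by
    obtain ⟨e, rfl⟩ := hg
    exact ⟨(ContinuousLinearEquiv.smulLeft (Units.mk0 k hk)).trans e,
      ContinuousLinearMap.ext fun v => map_smul e k v⟩
  ext v
  rw [rot, ContinuousLinearMap.comp_apply, hkg.inverse_apply_eq, volForm_smul]
  simp only [rot, smul_apply, map_smul, ContinuousLinearMap.comp_apply, hg.self_apply_inverse]
  rw [smul_smul, mul_right_comm, inv_mul_cancel₀ hk, one_mul]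

theorem rot_smul_of_pos {g : T →L[ℝ] T →L[ℝ] ℝ} (hg : g.IsInvertible) {k : ℝ} (hk : 0 < k)
    (o : Orientation ℝ T (Fin 2)) : rot (k • g) o = rot g o := by
  rw [rot_smul hg hk.ne', abs_of_pos hk, inv_mul_cancel₀ hk.ne', one_smul]

theorem rot_smul_neg_of_neg {g : T →L[ℝ] T →L[ℝ] ℝ} (hg : g.IsInvertible) {k : ℝ} (hk : k < 0)
    (o : Orientation ℝ T (Fin 2)) : rot (k • g) (-o) = rot g o := by
  rw [rot_neg, rot_smul hg hk.ne, abs_of_neg hk, mul_neg, inv_mul_cancel₀ hk.ne, neg_smul, one_smul,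
    neg_neg]

section Naturality

variable {T' : Type*} [AddCommGroup T'] [Module ℝ T'] [TopologicalSpace T']
  [IsTopologicalAddGroup T'] [ContinuousSMul ℝ T'] [T2Space T'] [FiniteDimensional ℝ T']
  [Fact (Module.finrank ℝ T' = 2)] (e : T ≃L[ℝ] T')
  (o : Orientation ℝ T (Fin 2))

theorem volForm_pullback (g : T' →L[ℝ] T' →L[ℝ] ℝ) (v w : T) :
    volForm (pullback g (e : T →L[ℝ] T')) o v w =
      volForm g (Orientation.map (Fin 2) e.toLinearEquiv o) (e v) (e w) := by
  have hb : (posBasis o).orientation = o := Orientation.someBasis_orientation _ _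
  have hb' : ((posBasis o).map e.toLinearEquiv).orientation =
      Orientation.map (Fin 2) e.toLinearEquiv o := by
    rw [Module.Basis.orientation_map, hb]
  rw [volForm_apply _ hb, volForm_apply _ hb']
  simp [basis_det_apply, gramDet, pullback]

theorem hodge_pullback {F : Type*} [AddCommGroup F] [Module ℝ F] [TopologicalSpace F]
    [IsTopologicalAddGroup F] {g : T' →L[ℝ] T' →L[ℝ] ℝ} (hg : g.IsInvertible) (α : T' →L[ℝ] F) :
    hodge (pullback g (e : T →L[ℝ] T')) o (α ∘L e) =
      hodge g (Orientation.map (Fin 2) e.toLinearEquiv o) α ∘L e := by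
  have hpull : (pullback g (e : T →L[ℝ] T')).IsInvertible := by
    obtain ⟨h, rfl⟩ := hg
    exact ⟨(e.trans h).trans (e.symm.arrowCongr (.refl ℝ ℝ)), ContinuousLinearMap.ext fun _ => rfl⟩
  have hrot (v : T) : e (rot (pullback g (e : T →L[ℝ] T')) o v) =
      rot g (Orientation.map (Fin 2) e.toLinearEquiv o) (e v) := by
    rw [← e.eq_symm_apply, rot, ContinuousLinearMap.comp_apply, hpull.inverse_apply_eq]
    ext w
    rw [volForm_pullback]
    simp [pullback, rot, hg.self_apply_inverse]
  ext v
  simp [hodge, hrot]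

end Naturality
end Plane

section Signature

variable {T : Type*} [AddCommGroup T] [Module ℝ T] [TopologicalSpace T] {K : Kind}
  {g : T →L[ℝ] T →L[ℝ] ℝ}

theorem Kind.hasSignature_iff_of_ne_timelike (hK : K ≠ .timelike) :
    K.HasSignature g ↔ ∀ v, v ≠ 0 → 0 < g v v := by
  cases K <;> first | rfl | exact absurd rfl hK

theorem Kind.frameSign_of_ne_timelike (hK : K ≠ .timelike) : K.frameSign = 1 := by
  cases K <;> first | rfl | exact absurd rfl hK

theorem Kind.HasSignature.smul (hg : K.HasSignature g) {k : ℝ} (hk : k ≠ 0)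
    (hpos : 0 < k ∨ K = .timelike) : K.HasSignature (k • g) := by
  rcases eq_or_ne K .timelike with rfl | hK
  · obtain ⟨⟨v, hv⟩, w, hw⟩ := hg
    rcases hk.lt_or_gt with hk | hk
    · exact ⟨⟨w, mul_pos_of_neg_of_neg hk hw⟩, v, mul_neg_of_neg_of_pos hk hv⟩
    · exact ⟨⟨v, mul_pos hk hv⟩, w, mul_neg_of_pos_of_neg hk hw⟩
  · rw [hasSignature_iff_of_ne_timelike hK] at hg ⊢
    exact fun v hv => mul_pos (hpos.resolve_right hK) (hg v hv)

theorem exists_smul_form_self_eq {σ : ℝ} (hσ : σ * σ = 1) {w : T} (hw : 0 < σ * g w w) :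
    ∃ k : ℝ, g (k • w) (k • w) = σ := by
  refine ⟨(√(σ * g w w))⁻¹, ?_⟩
  simp only [map_smul, smul_apply, smul_eq_mul]
  rw [← mul_assoc, ← mul_inv, Real.mul_self_sqrt hw.le, inv_mul_eq_iff_eq_mul₀ hw.ne']
  linear_combination -g w w * hσ

theorem Kind.HasSignature.exists_orthogonal (hg : K.HasSignature g) (hsymm : ∀ v w, g v w = g w v)
    [Fact (Module.finrank ℝ T = 2)] :
    ∃ v w, 0 < g v v ∧ g v w = 0 ∧ 0 < K.frameSign * g w w := by
  rcases eq_or_ne K .timelike with rfl | hK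
  · obtain ⟨⟨v, hv⟩, u, hu⟩ := hg
    obtain ⟨w, hw⟩ : ∃ w, w = u - (g v u / g v v) • v := ⟨_, rfl⟩
    have hvw : g v w = 0 := by simp [hw, hv.ne']
    refine ⟨v, w, hv, hvw, ?_⟩
    have hww : g w w = g u u - g v u ^ 2 / g v v :=
      calc g w w = g w (u - (g v u / g v v) • v) := congrArg (g w) hw
        _ = g u w := by rw [map_sub, map_smul, hsymm w v, hvw, smul_zero, sub_zero, hsymm]
        _ = g u u - g v u ^ 2 / g v v := by
          rw [hw, map_sub, map_smul, hsymm u v, smul_eq_mul]; ring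
    have hsq : 0 ≤ g v u ^ 2 / g v v := by positivity
    rw [hww, Kind.frameSign]
    linarith
  · rw [hasSignature_iff_of_ne_timelike hK] at hg
    have hrank : Module.finrank ℝ T = 2 := Fact.out
    have : FiniteDimensional ℝ T := .of_finrank_pos (hrank ▸ two_pos)
    let b := Module.finBasisOfFinrankEq ℝ T hrank
    have hv := hg (b 0) (b.ne_zero 0)
    refine ⟨b 0, b 1 - (g (b 0) (b 1) / g (b 0) (b 0)) • b 0, hv, by simp [hv.ne'], ?_⟩
    rw [frameSign_of_ne_timelike hK, one_mul]
    refine hg _ fun h0 => ?_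
    simpa using congrArg (fun u => b.repr u 1) h0

variable (K g) in
/-- The basis `b` is a positively oriented orthonormal frame: `⟨b₀, b₀⟩ = 1` and `⟨b₁, b₁⟩` is the
frame sign of the kind of surface. -/
structure IsOrthonormalFrame (o : Orientation ℝ T (Fin 2)) (b : Module.Basis (Fin 2) ℝ T) :
    Prop where
  orientation : b.orientation = o
  zero_zero : g (b 0) (b 0) = 1
  zero_one : g (b 0) (b 1) = 0
  one_zero : g (b 1) (b 0) = 0
  one_one : g (b 1) (b 1) = K.frameSign

theorem Kind.HasSignature.exists_orthonormal [Fact (Module.finrank ℝ T = 2)]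
    (hg : K.HasSignature g) (hsymm : ∀ v w, g v w = g w v) :
    ∃ v w, g v v = 1 ∧ g v w = 0 ∧ g w v = 0 ∧ g w w = K.frameSign := by
  obtain ⟨v, w, hv, hvw, hw⟩ := hg.exists_orthogonal hsymm
  obtain ⟨k, hk⟩ := exists_smul_form_self_eq (one_mul 1) (g := g) (by rwa [one_mul])
  obtain ⟨l, hl⟩ := exists_smul_form_self_eq K.frameSign_mul_self hw
  have hkl : g (k • v) (l • w) = 0 := by simp [hvw]
  exact ⟨k • v, l • w, hk, hkl, hsymm _ _ ▸ hkl, hl⟩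

theorem Kind.HasSignature.exists_isOrthonormalFrame [Fact (Module.finrank ℝ T = 2)]
    (hg : K.HasSignature g) (hsymm : ∀ v w, g v w = g w v) (o : Orientation ℝ T (Fin 2)) :
    ∃ b, IsOrthonormalFrame K g o b := by
  obtain ⟨v, w, hvv, hvw, hwv, hww⟩ := hg.exists_orthonormal hsymm
  have hlin : LinearIndependent ℝ ![v, w] := by
    refine LinearIndependent.pair_iff.2 fun s t hst => ⟨?_, ?_⟩
    · simpa [hvv, hvw] using congrArg (g v) hst
    · simpa [hww, hwv, K.frameSign_ne_zero] using congrArg (g w) hst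
  let b := basisOfLinearIndependentOfCardEqFinrank hlin
    ((Fintype.card_fin 2).trans (Fact.out : Module.finrank ℝ T = 2).symm)
  have hb0 : b 0 = v := by simp [b]
  have hb1 : b 1 = w := by simp [b]
  refine ⟨b.adjustToOrientation o, b.orientation_adjustToOrientation o, ?_, ?_, ?_, ?_⟩ <;>
  rcases b.adjustToOrientation_apply_eq_or_eq_neg o 0 with h0 | h0 <;>
  rcases b.adjustToOrientation_apply_eq_or_eq_neg o 1 with h1 | h1 <;>
  simp only [h0, h1, hb0, hb1, hvv, hvw, hwv, hww, map_neg, neg_apply, neg_neg, neg_zero]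

theorem IsOrthonormalFrame.gramDet_eq {o : Orientation ℝ T (Fin 2)}
    {b : Module.Basis (Fin 2) ℝ T} (h : IsOrthonormalFrame K g o b) :
    gramDet g b = K.frameSign := by
  rw [gramDet, h.zero_zero, h.zero_one, h.one_zero, h.one_one]
  ring

theorem Kind.HasSignature.gramDet_ne_zero [Fact (Module.finrank ℝ T = 2)]
    (hg : K.HasSignature g) (hsymm : ∀ v w, g v w = g w v) (b : Module.Basis (Fin 2) ℝ T) :
    gramDet g b ≠ 0 := by
  obtain ⟨e, he⟩ := hg.exists_isOrthonormalFrame hsymm b.orientation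
  rw [gramDet_eq_det_sq_mul g e b, he.gramDet_eq]
  exact mul_ne_zero (pow_ne_zero 2 (e.isUnit_det b).ne_zero) K.frameSign_ne_zero

variable [IsTopologicalAddGroup T] [ContinuousSMul ℝ T] [T2Space T] [FiniteDimensional ℝ T]

namespace IsOrthonormalFrame

variable {o : Orientation ℝ T (Fin 2)} {b : Module.Basis (Fin 2) ℝ T}

theorem isInvertible (h : IsOrthonormalFrame K g o b) : g.IsInvertible :=
  isInvertible_of_gramDet_ne_zero (h.gramDet_eq ▸ K.frameSign_ne_zero)

theorem inverse_apply (h : IsOrthonormalFrame K g o b) (ψ : T →L[ℝ] ℝ) :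
    g.inverse ψ = ψ (b 0) • b 0 + (K.frameSign * ψ (b 1)) • b 1 := by
  rw [h.isInvertible.inverse_apply_eq]
  refine clm_ext_basis b ?_ ?_ <;>
    simp only [map_add, map_smul, add_apply, smul_apply, smul_eq_mul, h.zero_zero, h.zero_one,
      h.one_zero, h.one_one]
  · ring
  · linear_combination -ψ (b 1) * K.frameSign_mul_self

theorem trace_inverse_comp (h : IsOrthonormalFrame K g o b) (f : T →L[ℝ] T →L[ℝ] ℝ) :
    LinearMap.trace ℝ T (g.inverse ∘L f).toLinearMap =
      f (b 0) (b 0) + K.frameSign * f (b 1) (b 1) := by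
  rw [LinearMap.trace_eq_matrix_trace ℝ b, Matrix.trace_fin_two]
  simp [LinearMap.toMatrix_apply, h.inverse_apply]

variable [Fact (Module.finrank ℝ T = 2)]

theorem volForm_eq_det (h : IsOrthonormalFrame K g o b) (v w : T) :
    volForm g o v w = b.det ![v, w] := by
  have hgram : |gramDet g b| = 1 := by
    rw [h.gramDet_eq, ← sq_eq_sq₀ (abs_nonneg _) zero_le_one, sq_abs, sq, K.frameSign_mul_self,
      one_pow]
  rw [volForm_apply g h.orientation, hgram, Real.sqrt_one, one_mul]

theorem rot_apply (h : IsOrthonormalFrame K g o b) (v : T) :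
    rot g o v = -b.repr v 1 • b 0 + (K.frameSign * b.repr v 0) • b 1 := by
  rw [rot, ContinuousLinearMap.comp_apply, h.inverse_apply, h.volForm_eq_det, h.volForm_eq_det]
  simp [basis_det_apply]

theorem rot_rot (h : IsOrthonormalFrame K g o b) (v : T) :
    rot g o (rot g o v) = -(K.frameSign • v) := by
  conv_rhs => rw [← basis_sum_repr b v]
  simp [h.rot_apply, smul_smul, add_comm]

theorem cross_hodge_symm (h : IsOrthonormalFrame K g o b) (β : T →L[ℝ] R3) (v w : T) :
    K.cross (β v) (hodge g o β w) = K.cross (β w) (hodge g o β v) := by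
  have hcoord (v w : T) : K.cross (β v) (hodge g o β w) =
      -(K.frameSign * (b.repr v 0 * b.repr w 0) + b.repr v 1 * b.repr w 1) •
        K.cross (β (b 0)) (β (b 1)) := by
    conv_lhs => rw [← basis_sum_repr b v]
    simp only [hodge, neg_apply, ContinuousLinearMap.comp_apply, h.rot_apply, map_add, map_neg,
      map_smul, ← K.crossL_apply, add_apply, smul_apply]
    simp only [K.crossL_apply, K.cross_self, K.cross_anticomm (β (b 1)) (β (b 0))]
    module
  rw [hcoord, hcoord, mul_comm (b.repr v 0), mul_comm (b.repr v 1)]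

end IsOrthonormalFrame
end Signature

section Conformal

variable {T : Type*} [AddCommGroup T] [Module ℝ T] [TopologicalSpace T] {K : Kind}
  {g : T →L[ℝ] T →L[ℝ] ℝ} {o : Orientation ℝ T (Fin 2)} {n : R3} {b : Module.Basis (Fin 2) ℝ T}
  {α β : T →L[ℝ] R3}

theorem form_gauss_self (hb : IsOrthonormalFrame K (pullback K.form α) o b)
    (hn : n = K.gaussSign • K.cross (α (b 0)) (α (b 1))) : K.form n n = K.normalSign := by
  have h00 : K.form (α (b 0)) (α (b 0)) = 1 := hb.zero_zero
  have h01 : K.form (α (b 0)) (α (b 1)) = 0 := hb.zero_one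
  have h11 : K.form (α (b 1)) (α (b 1)) = K.frameSign := hb.one_one
  have hδ := K.ambientSign_mul_self
  have hcross : K.form (K.cross (α (b 0)) (α (b 1))) (K.cross (α (b 0)) (α (b 1))) =
      K.ambientSign * K.frameSign := by
    rw [K.form_cross_left, K.cross_cross, h00, h01, zero_smul, one_smul, zero_sub, smul_neg,
      map_neg, neg_neg, map_smul, h11, smul_eq_mul]
  rw [hn, K.gaussSign_eq_ambientSign, map_smul, map_smul, smul_apply, hcross,
    ← K.ambientSign_mul_normalSign]
  simp only [smul_eq_mul, ← mul_assoc, hδ, one_mul]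

variable [IsTopologicalAddGroup T] [ContinuousSMul ℝ T] [T2Space T] [FiniteDimensional ℝ T]
  [Fact (Module.finrank ℝ T = 2)]

variable (K g o n) in
/-- The `ℝ³`-valued covector `α` takes values orthogonal to the unit vector `n` and intertwines the
complex (or, for timelike surfaces, paracomplex) structure `J` of the oriented plane with the
operator `± n ×`, so that it is a conformal map onto the plane orthogonal to `n`. -/
structure IsConformal (α : T →L[ℝ] R3) : Prop where
  orthogonal : ∀ v, K.form n (α v) = 0
  apply_rot : ∀ v, α (rot g o v) = K.frameSign • K.cross n (α v)

variable (K g o n) in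
/-- The covector `β + n × *β`: twice the conformal part of a covector `β` whose values are
orthogonal to `n`. -/
noncomputable def conformalPart (β : T →L[ℝ] R3) : T →L[ℝ] R3 :=
  β + K.cross n ∘L hodge g o β

theorem conformalPart_congr {g' : T →L[ℝ] T →L[ℝ] ℝ} {o' : Orientation ℝ T (Fin 2)}
    (h : rot g' o' = rot g o) : conformalPart K g' o' n β = conformalPart K g o n β := by
  rw [conformalPart, conformalPart, hodge, hodge, h]

theorem isConformal_conformalPart (hb : IsOrthonormalFrame K g o b)
    (hn : K.form n n = K.normalSign) (hβ : ∀ v, K.form n (β v) = 0) :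
    IsConformal K g o n (conformalPart K g o n β) where
  orthogonal v := by
    simp only [conformalPart, add_apply, map_add, ContinuousLinearMap.comp_apply, hβ,
      K.form_self_cross, add_zero]
  apply_rot v := by
    simp only [conformalPart, hodge, add_apply, neg_apply, ContinuousLinearMap.comp_apply,
      hb.rot_rot, map_add, map_neg, map_smul, Kind.cross_cross_of_orthogonal hn (hβ _), neg_neg,
      smul_add, smul_smul, K.frameSign_mul_self, one_smul, add_comm]

namespace IsConformal

theorem add (hα : IsConformal K g o n α) (hβ : IsConformal K g o n β) :
    IsConformal K g o n (α + β) where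
  orthogonal v := by rw [add_apply, map_add, hα.orthogonal, hβ.orthogonal, add_zero]
  apply_rot v := by simp only [add_apply, hα.apply_rot, hβ.apply_rot, map_add, smul_add]

theorem smul (hα : IsConformal K g o n α) (r : ℝ) : IsConformal K g o n (r • α) where
  orthogonal v := by rw [smul_apply, map_smul, hα.orthogonal, smul_zero]
  apply_rot v := by
    rw [smul_apply, smul_apply, hα.apply_rot, map_smul, smul_comm]

variable (hα : IsConformal K g o n α)
include hα

theorem apply_one (hb : IsOrthonormalFrame K g o b) : α (b 1) = K.cross n (α (b 0)) := by
  have h : K.frameSign • α (b 1) = K.frameSign • K.cross n (α (b 0)) := by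
    rw [← hα.apply_rot, hb.rot_apply]
    simp
  exact smul_right_injective _ K.frameSign_ne_zero h

theorem eq_zero (hb : IsOrthonormalFrame K g o b) (h0 : α (b 0) = 0) : α = 0 :=
  clm_ext_basis b h0 (by rw [hα.apply_one hb, h0, map_zero, zero_apply])

theorem cross_apply (hb : IsOrthonormalFrame K g o b) :
    K.cross (α (b 0)) (α (b 1)) = (K.ambientSign * K.form (α (b 0)) (α (b 0))) • n := by
  rw [hα.apply_one hb, K.cross_cross, K.form_comm (α (b 0)) n, hα.orthogonal, zero_smul, sub_zero,
    smul_smul]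

theorem pullback_form_eq (hb : IsOrthonormalFrame K g o b) (hn : K.form n n = K.normalSign) :
    pullback K.form α = K.form (α (b 0)) (α (b 0)) • g := by
  have h01 : K.form (α (b 0)) (α (b 1)) = 0 := by
    rw [hα.apply_one hb, ← self_eq_neg]
    conv_lhs => rw [K.form_comm, K.form_cross_left]
  have h11 : K.form (α (b 1)) (α (b 1)) = K.form (α (b 0)) (α (b 0)) * K.frameSign := by
    rw [hα.apply_one hb, K.form_cross_left,
      Kind.cross_cross_of_orthogonal hn (hα.orthogonal _), map_neg, map_smul, neg_neg, smul_eq_mul,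
      mul_comm]
  refine clm_ext_basis b (clm_ext_basis b ?_ ?_) (clm_ext_basis b ?_ ?_)
  · exact (mul_one _).symm.trans (congrArg _ hb.zero_zero.symm)
  · exact h01.trans ((mul_zero _).symm.trans (congrArg _ hb.zero_one.symm))
  · exact (K.form_comm _ _).trans (h01.trans ((mul_zero _).symm.trans
      (congrArg _ hb.one_zero.symm)))
  · exact h11.trans (congrArg _ hb.one_one.symm)

theorem form_conformalPart_zero (hb : IsOrthonormalFrame K g o b) :
    K.form (α (b 0)) (conformalPart K g o n β (b 0)) =
      K.form (α (b 0)) (β (b 0)) + K.frameSign * K.form (α (b 1)) (β (b 1)) := by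
  have hskew := K.form_cross_left n (α (b 0)) (β (b 1))
  rw [hα.apply_one hb, hskew]
  simp [conformalPart, hodge, hb.rot_apply]

theorem form_conformalPart_one (hb : IsOrthonormalFrame K g o b)
    (hn : K.form n n = K.normalSign) :
    K.form (α (b 1)) (conformalPart K g o n β (b 0)) =
      K.form (α (b 1)) (β (b 0)) - K.form (α (b 0)) (β (b 1)) := by
  have hskew := K.form_cross_left n (α (b 1)) (β (b 1))
  rw [hα.apply_one hb, Kind.cross_cross_of_orthogonal hn (hα.orthogonal _), map_neg, map_smul,
    neg_apply, smul_apply, neg_inj] at hskew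
  rw [hα.apply_one hb]
  simp [conformalPart, hodge, hb.rot_apply, ← hskew, ← mul_assoc, K.frameSign_mul_self,
    sub_eq_add_neg]

theorem conformalFactor_pos (hK : K ≠ .timelike) (hb : IsOrthonormalFrame K g o b)
    (hn : K.form n n = K.normalSign) (h0 : α ≠ 0) : 0 < K.form (α (b 0)) (α (b 0)) :=
  Kind.form_self_pos_of_orthogonal hK hn (hα.orthogonal _) fun h => h0 (hα.eq_zero hb h)

theorem conformalFactor_ne_zero (hb : IsOrthonormalFrame K g o b)
    (hinj : ∀ v, v ≠ 0 → α v ≠ 0) : K.form (α (b 0)) (α (b 0)) ≠ 0 := by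
  have hind : LinearIndependent ℝ ![α (b 0), α (b 1)] := by
    refine LinearIndependent.pair_iff.2 fun s t hst => ?_
    have h0 : s • b 0 + t • b 1 = 0 := by
      by_contra h
      exact hinj _ h (by simpa only [map_add, map_smul] using hst)
    have hb01 : (b : Fin 2 → T) = ![b 0, b 1] := funext (Fin.forall_fin_two.2 ⟨rfl, rfl⟩)
    exact LinearIndependent.pair_iff.1 (hb01 ▸ b.linearIndependent) s t h0
  intro hc
  exact K.cross_ne_zero hind (by rw [hα.cross_apply hb, hc, mul_zero, zero_smul])

end IsConformal

theorem isConformal_of_gauss (hb : IsOrthonormalFrame K (pullback K.form α) o b)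
    (hn : n = K.gaussSign • K.cross (α (b 0)) (α (b 1))) :
    IsConformal K (pullback K.form α) o n α := by
  have h00 : K.form (α (b 0)) (α (b 0)) = 1 := hb.zero_zero
  have h01 : K.form (α (b 0)) (α (b 1)) = 0 := hb.zero_one
  have h10 : K.form (α (b 1)) (α (b 0)) = 0 := hb.one_zero
  have h11 : K.form (α (b 1)) (α (b 1)) = K.frameSign := hb.one_one
  have hδ := K.ambientSign_mul_self
  have hcross (z : R3) : K.cross n z =
      K.form z (α (b 0)) • α (b 1) - K.form z (α (b 1)) • α (b 0) := by
    rw [K.cross_anticomm, hn, map_smul, K.cross_cross, K.gaussSign_eq_ambientSign, smul_smul, hδ,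
      one_smul, neg_sub]
  have horth : K.form n ∘L α = 0 := by
    refine clm_ext_basis b ?_ ?_
    · simp [hn, K.form_comm _ (α (b 0)), K.form_self_cross]
    · simp [hn, K.form_comm _ (α (b 1)), K.cross_anticomm (α (b 0)), K.form_self_cross]
  have hrot : α ∘L rot (pullback K.form α) o = K.frameSign • K.cross n ∘L α := by
    refine clm_ext_basis b ?_ ?_
    · simp [hb.rot_apply, hcross, h00, h01]
    · simp [hb.rot_apply, hcross, h10, h11, smul_smul, K.frameSign_mul_self]
  exact ⟨DFunLike.congr_fun horth, DFunLike.congr_fun hrot⟩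

theorem IsConformal.eq_gauss (hα : IsConformal K (pullback K.form α) o n α)
    (hb : IsOrthonormalFrame K (pullback K.form α) o b) :
    n = K.gaussSign • K.cross (α (b 0)) (α (b 1)) := by
  have h00 : K.form (α (b 0)) (α (b 0)) = 1 := hb.zero_zero
  rw [hα.cross_apply hb, h00, mul_one, K.gaussSign_eq_ambientSign, smul_smul,
    K.ambientSign_mul_self, one_smul]

end Conformal

section Gluing

variable {X F : Type*} [TopologicalSpace X] [AddCommGroup F] {U : X → Set X} {f : X → X → F}

/-- The fibre bundle over `X` with discrete fibre `F` whose sections are the functions that differ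
from each `f i` by a locally constant function on `U i`. -/
def gluingBundle [TopologicalSpace F] [DiscreteTopology F] (hU : ∀ i, IsOpen (U i))
    (hmem : ∀ x, x ∈ U x)
    (hf : ∀ i j, ∀ x ∈ U i ∩ U j, ∀ᶠ z in 𝓝 x, f i z - f j z = f i x - f j x) :
    FiberBundleCore X X F where
  baseSet := U
  isOpen_baseSet := hU
  indexAt := id
  mem_baseSet_at := hmem
  coordChange i j x v := v + f i x - f j x
  coordChange_self i x _ v := by abel
  continuousOn_coordChange := by
    rintro i j ⟨x, v⟩ ⟨hx, -⟩
    refine ContinuousAt.continuousWithinAt (continuousAt_const.congr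
      (f := fun _ => v + (f i x - f j x)) ?_)
    filter_upwards [continuous_fst.continuousAt.eventually (hf i j x hx),
      continuous_snd.continuousAt.eventually_mem (mem_nhds_discrete.2 rfl : {v} ∈ 𝓝 v)]
      with p hp (hpv : p.2 = v)
    rw [hpv, ← hp, add_sub_assoc]
  coordChange_comp i j k x _ v := by abel

theorem exists_global_of_locally_constant_sub [SimplyConnectedSpace X]
    [LocallyPathConnectedSpace X] (hU : ∀ i, IsOpen (U i)) (hmem : ∀ x, x ∈ U x)
    (hf : ∀ i j, ∀ x ∈ U i ∩ U j, ∀ᶠ z in 𝓝 x, f i z - f j z = f i x - f j x) :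
    ∃ y : X → F, ∀ x, ∀ᶠ z in 𝓝 x, y z - f x z = y x - f x x := by
  let _ : TopologicalSpace F := ⊥
  have : DiscreteTopology F := ⟨rfl⟩
  let Z := gluingBundle hU hmem hf
  have hcov : IsCoveringMap Z.proj := FiberBundle.isCoveringMap
  obtain ⟨x₀⟩ : Nonempty X := inferInstance
  obtain ⟨s, ⟨-, hs⟩, -⟩ := hcov.existsUnique_continuousMap_lifts (ContinuousMap.id X) x₀
    (⟨x₀, (0 : F)⟩ : Z.TotalSpace) rfl
  have hproj (x : X) : (s x).proj = x := congrFun hs x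
  let c (x : X) : F := (s x).snd
  refine ⟨fun x => c x + f x x, fun x => ?_⟩
  have hcoord (z : X) : (Z.localTriv x (s z)).2 = c z + f z z - f x z := by
    change c z + f (s z).proj (s z).proj - f x (s z).proj = _
    rw [hproj]
  have hcont : ContinuousAt (fun z => (Z.localTriv x (s z)).2) x := by
    refine continuous_snd.continuousAt.comp
      (((Z.localTriv x).continuousAt ?_).comp s.continuous.continuousAt)
    rw [(Z.localTriv x).mem_source]
    exact (congrArg (· ∈ U x) (hproj x)).mpr (hmem x)
  filter_upwards [hcont.eventually_mem (mem_nhds_discrete.2 rfl :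
    {(Z.localTriv x (s x)).2} ∈ 𝓝 _)] with z hz
  rw [← hcoord, ← hcoord]
  exact hz

end Gluing

section Charts

variable {M : Type*} [TopologicalSpace M] [ChartedSpace R2 M]

theorem extChartAt_target_mem_nhds_of_mem (p : M) {y : R2} (hy : y ∈ (extChartAt (𝓡 2) p).target) :
    (extChartAt (𝓡 2) p).target ∈ 𝓝 y :=
  (isOpen_extChartAt_target p).mem_nhds hy

variable [IsManifold (𝓡 2) ∞ M] {p : M} {y : R2}

theorem contMDiffAt_extChartAt_symm (hy : y ∈ (extChartAt (𝓡 2) p).target) :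
    ContMDiffAt 𝓘(ℝ, R2) (𝓡 2) ∞ (extChartAt (𝓡 2) p).symm y :=
  (contMDiffOn_extChartAt_symm p).contMDiffAt (extChartAt_target_mem_nhds_of_mem p hy)

theorem hasMFDerivAt_extChartAt_symm (hy : y ∈ (extChartAt (𝓡 2) p).target) :
    HasMFDerivAt 𝓘(ℝ, R2) (𝓡 2) (extChartAt (𝓡 2) p).symm y
      (mfderiv 𝓘(ℝ, R2) (𝓡 2) (extChartAt (𝓡 2) p).symm y) :=
  ((contMDiffAt_extChartAt_symm hy).mdifferentiableAt (by simp)).hasMFDerivAt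

theorem hasFDerivAt_comp_extChartAt_symm {f : M → R3} (hy : y ∈ (extChartAt (𝓡 2) p).target)
    (hf : MDifferentiableAt (𝓡 2) 𝓘(ℝ, R3) f ((extChartAt (𝓡 2) p).symm y)) :
    HasFDerivAt (f ∘ (extChartAt (𝓡 2) p).symm) (chartForm (mvfderiv (𝓡 2) f) p y) y :=
  (hf.hasMFDerivAt.comp y (hasMFDerivAt_extChartAt_symm hy)).hasFDerivAt

theorem chartForm_comp_mfderiv_extChartAt (θ : ∀ q : M, TangentSpace (𝓡 2) q →L[ℝ] R3) {q : M}
    (hq : q ∈ (extChartAt (𝓡 2) p).source) (w : TangentSpace (𝓡 2) q) :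
    chartForm θ p (extChartAt (𝓡 2) p q) (mfderiv (𝓡 2) 𝓘(ℝ, R2) (extChartAt (𝓡 2) p) q w) =
      θ q w := by
  have h := mfderivWithin_extChartAt_symm_comp_mfderiv_extChartAt' (I := 𝓡 2) hq
  rw [ModelWithCorners.range_eq_univ, mfderivWithin_univ] at h
  have hθ {q' : M} (hq' : q' = q) (u : R2) : θ q' u = θ q u := by subst hq'; rfl
  exact (congrArg (θ _) (DFunLike.congr_fun h w)).trans
    (hθ ((extChartAt (𝓡 2) p).left_inv hq) w)

theorem contDiffAt_extChartAt_comp_symm {q : M} (hy : y ∈ (extChartAt (𝓡 2) p).target)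
    (hyq : (extChartAt (𝓡 2) p).symm y ∈ (extChartAt (𝓡 2) q).source) :
    ContDiffAt ℝ ∞ (extChartAt (𝓡 2) q ∘ (extChartAt (𝓡 2) p).symm) y := by
  rw [extChartAt_source] at hyq
  exact ((contMDiffAt_extChartAt' hyq).comp y (contMDiffAt_extChartAt_symm hy)).contDiffAt

theorem chartForm_change (θ : ∀ q : M, TangentSpace (𝓡 2) q →L[ℝ] R3) {q : M}
    (hy : y ∈ (extChartAt (𝓡 2) p).target)
    (hyq : (extChartAt (𝓡 2) p).symm y ∈ (extChartAt (𝓡 2) q).source) :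
    chartForm θ p y =
      chartForm θ q (extChartAt (𝓡 2) q ((extChartAt (𝓡 2) p).symm y)) ∘L
        fderiv ℝ (extChartAt (𝓡 2) q ∘ (extChartAt (𝓡 2) p).symm) y := by
  have hd : MDifferentiableAt (𝓡 2) 𝓘(ℝ, R2) (extChartAt (𝓡 2) q) ((extChartAt (𝓡 2) p).symm y) :=
    mdifferentiableAt_extChartAt (by rwa [extChartAt_source] at hyq)
  have hchange : HasFDerivAt (extChartAt (𝓡 2) q ∘ (extChartAt (𝓡 2) p).symm) (_ : R2 →L[ℝ] R2) y :=
    (hd.hasMFDerivAt.comp y (hasMFDerivAt_extChartAt_symm hy)).hasFDerivAt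
  rw [hchange.fderiv]
  ext1 v
  exact (chartForm_comp_mfderiv_extChartAt θ hyq _).symm

end Charts

section Primitives

variable {M : Type*} [TopologicalSpace M] [ChartedSpace R2 M]

/-- Smoothness of a 1-form, tested at each point in the chart around that point. -/
def IsSmoothForm (θ : ∀ q : M, TangentSpace (𝓡 2) q →L[ℝ] R3) : Prop :=
  ∀ p, ContDiffAt ℝ ∞ (chartForm θ p) (extChartAt (𝓡 2) p p)

variable [IsManifold (𝓡 2) ∞ M] {θ : ∀ q : M, TangentSpace (𝓡 2) q →L[ℝ] R3}

theorem chartForm_eventuallyEq (θ : ∀ q : M, TangentSpace (𝓡 2) q →L[ℝ] R3) {p q : M} {y : R2}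
    (hy : y ∈ (extChartAt (𝓡 2) p).target)
    (hyq : (extChartAt (𝓡 2) p).symm y ∈ (extChartAt (𝓡 2) q).source) :
    chartForm θ p =ᶠ[𝓝 y] fun z =>
      chartForm θ q ((extChartAt (𝓡 2) q ∘ (extChartAt (𝓡 2) p).symm) z) ∘L
        fderiv ℝ (extChartAt (𝓡 2) q ∘ (extChartAt (𝓡 2) p).symm) z := by
  filter_upwards [extChartAt_target_mem_nhds_of_mem p hy,
    (contMDiffAt_extChartAt_symm hy).continuousAt.preimage_mem_nhds
      (extChartAt_source_mem_nhds' hyq)] with z hz hzq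
  exact chartForm_change θ hz hzq

theorem IsSmoothForm.contDiffAt_chartForm (hθ : IsSmoothForm θ) {p : M} {y : R2}
    (hy : y ∈ (extChartAt (𝓡 2) p).target) : ContDiffAt ℝ ∞ (chartForm θ p) y := by
  set q := (extChartAt (𝓡 2) p).symm y
  have hyq : q ∈ (extChartAt (𝓡 2) q).source := mem_extChartAt_source q
  have hψ := contDiffAt_extChartAt_comp_symm hy hyq
  have hcomp : ContDiffAt ℝ ∞
      (fun z => chartForm θ q ((extChartAt (𝓡 2) q ∘ (extChartAt (𝓡 2) p).symm) z)) y :=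
    ContDiffAt.comp (f := extChartAt (𝓡 2) q ∘ (extChartAt (𝓡 2) p).symm) y (hθ q) hψ
  exact (hcomp.clm_comp (hψ.fderiv_right (by simp))).congr_of_eventuallyEq
    (chartForm_eventuallyEq θ hy hyq)

theorem IsSmoothForm.fderiv_chartForm_symm (hθ : IsSmoothForm θ)
    (hclosed : ∀ q v w, extDerivOne θ q v w = 0) {p : M} {y : R2}
    (hy : y ∈ (extChartAt (𝓡 2) p).target) (v w : R2) :
    fderiv ℝ (chartForm θ p) y v w = fderiv ℝ (chartForm θ p) y w v := by
  set q := (extChartAt (𝓡 2) p).symm y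
  set ψ := extChartAt (𝓡 2) q ∘ (extChartAt (𝓡 2) p).symm
  have hyq : q ∈ (extChartAt (𝓡 2) q).source := mem_extChartAt_source q
  have hψ : ContDiffAt ℝ ∞ ψ y := contDiffAt_extChartAt_comp_symm hy hyq
  have hψ' : DifferentiableAt ℝ (fderiv ℝ ψ) y :=
    (hψ.fderiv_right (m := ∞) (by simp)).differentiableAt (by simp)
  have hsymm : IsSymmSndFDerivAt ℝ ψ y := hψ.isSymmSndFDerivAt (by simp; norm_cast)
  have hcomp : HasFDerivAt (chartForm θ q ∘ ψ) _ y :=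
    ((hθ q).differentiableAt (by simp)).hasFDerivAt.comp y
      (hψ.differentiableAt (by simp)).hasFDerivAt
  have hcl : fderiv ℝ (chartForm θ q) (extChartAt (𝓡 2) q q) (fderiv ℝ ψ y v) (fderiv ℝ ψ y w) =
      fderiv ℝ (chartForm θ q) (extChartAt (𝓡 2) q q) (fderiv ℝ ψ y w) (fderiv ℝ ψ y v) :=
    sub_eq_zero.1 (hclosed q (fderiv ℝ ψ y v) (fderiv ℝ ψ y w))
  have hform := (hcomp.clm_comp hψ'.hasFDerivAt).congr_of_eventuallyEq
    (chartForm_eventuallyEq θ hy hyq)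
  rw [hform.fderiv]
  simp only [add_apply, ContinuousLinearMap.comp_apply, ContinuousLinearMap.compL_apply,
    ContinuousLinearMap.flip_apply]
  rw [hsymm v w, hcl]

theorem IsSmoothForm.exists_local_primitive (hθ : IsSmoothForm θ)
    (hclosed : ∀ q v w, extDerivOne θ q v w = 0) (p : M) :
    ∃ (U : Set M) (f : M → R3), IsOpen U ∧ p ∈ U ∧
      ∀ q ∈ U, MDifferentiableAt (𝓡 2) 𝓘(ℝ, R3) f q ∧ mvfderiv (𝓡 2) f q = θ q := by
  obtain ⟨r, hr, hball⟩ := Metric.mem_nhds_iff.1 (extChartAt_target_mem_nhds (I := 𝓡 2) p)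
  obtain ⟨f, hf⟩ := (convex_ball (extChartAt (𝓡 2) p p)
    r).exists_forall_hasFDerivAt_of_fderiv_symmetric Metric.isOpen_ball
    (fun y hy => ((hθ.contDiffAt_chartForm (hball hy)).differentiableAt
      (by simp)).differentiableWithinAt)
    (fun y hy => hθ.fderiv_chartForm_symm hclosed (hball hy))
  refine ⟨(extChartAt (𝓡 2) p).source ∩
      extChartAt (𝓡 2) p ⁻¹' Metric.ball (extChartAt (𝓡 2) p p) r,
    f ∘ extChartAt (𝓡 2) p, (continuousOn_extChartAt p).isOpen_inter_preimage
      (isOpen_extChartAt_source p) Metric.isOpen_ball,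
    ⟨mem_extChartAt_source p, Metric.mem_ball_self hr⟩, fun q ⟨hq, hqr⟩ => ?_⟩
  have hchart : MDifferentiableAt (𝓡 2) 𝓘(ℝ, R2) (extChartAt (𝓡 2) p) q :=
    mdifferentiableAt_extChartAt (by rwa [extChartAt_source] at hq)
  have hfq := (hf _ hqr).hasMFDerivAt.comp q hchart.hasMFDerivAt
  refine ⟨hfq.mdifferentiableAt, ?_⟩
  ext1 w
  exact (DFunLike.congr_fun hfq.mfderiv w).trans (chartForm_comp_mfderiv_extChartAt θ hq w)

theorem eventually_eq_of_mvfderiv_eq_zero {f : M → R3} {x : M}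
    (hf : ∀ᶠ z in 𝓝 x, MDifferentiableAt (𝓡 2) 𝓘(ℝ, R3) f z ∧ mvfderiv (𝓡 2) f z = 0) :
    ∀ᶠ z in 𝓝 x, f z = f x := by
  obtain ⟨r, hr, hball⟩ := Metric.mem_nhds_iff.1 (Filter.inter_mem
    ((continuousAt_extChartAt_symm (I := 𝓡 2) x).eventually
      (by rwa [extChartAt_to_inv (I := 𝓡 2) x]))
    (extChartAt_target_mem_nhds (I := 𝓡 2) x))
  have hder (y : R2) (hy : y ∈ Metric.ball (extChartAt (𝓡 2) x x) r) :
      HasFDerivAt (f ∘ (extChartAt (𝓡 2) x).symm) (0 : R2 →L[ℝ] R3) y := by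
    obtain ⟨⟨hfd, hf0⟩, hyt⟩ := hball hy
    have h0 : chartForm (mvfderiv (𝓡 2) f) x y = 0 := by
      ext1 v
      exact DFunLike.congr_fun hf0 _
    exact h0 ▸ hasFDerivAt_comp_extChartAt_symm hyt hfd
  filter_upwards [(continuousAt_extChartAt (I := 𝓡 2) x).eventually (Metric.ball_mem_nhds _ hr),
    extChartAt_source_mem_nhds (I := 𝓡 2) x] with z hz hzs
  have hconst := Metric.isOpen_ball.is_const_of_fderiv_eq_zero
    (convex_ball (extChartAt (𝓡 2) x x) r).isPreconnected
    (fun y hy => (hder y hy).differentiableAt.differentiableWithinAt)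
    (fun y hy => (hder y hy).fderiv) hz (Metric.mem_ball_self hr)
  rwa [Function.comp_apply, Function.comp_apply, (extChartAt (𝓡 2) x).left_inv hzs,
    extChartAt_to_inv] at hconst

theorem IsSmoothForm.exists_isPrimitive [SimplyConnectedSpace M] (hθ : IsSmoothForm θ)
    (hclosed : ∀ q v w, extDerivOne θ q v w = 0) : ∃ y, IsPrimitive θ y := by
  choose U f hU hmem hf using hθ.exists_local_primitive hclosed
  have : LocallyPathConnectedSpace M := ChartedSpace.locallyPathConnectedSpace R2 M
  obtain ⟨y, hy⟩ := exists_global_of_locally_constant_sub hU hmem (f := f) (by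
    rintro i j x ⟨hi, hj⟩
    refine eventually_eq_of_mvfderiv_eq_zero (f := f i - f j) ?_
    filter_upwards [(hU i).mem_nhds hi, (hU j).mem_nhds hj] with z hzi hzj
    obtain ⟨hdi, hθi⟩ := hf i z hzi
    obtain ⟨hdj, hθj⟩ := hf j z hzj
    exact ⟨hdi.sub hdj, by rw [mvfderiv_sub hdi hdj, hθi, hθj, sub_self]⟩)
  have hyf (x : M) : y =ᶠ[𝓝 x] f x + fun _ => y x - f x x := by
    filter_upwards [hy x] with z hz
    rw [Pi.add_apply, ← hz, add_sub_cancel]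
  have hderiv (x : M) : MDifferentiableAt (𝓡 2) 𝓘(ℝ, R3) y x ∧ mvfderiv (𝓡 2) y x = θ x := by
    obtain ⟨hd, hθx⟩ := hf x x (hmem x)
    have h := (hd.hasMFDerivAt.add (hasMFDerivAt_const (y x - f x x) x)).congr_of_eventuallyEq
      (hyf x)
    refine ⟨h.mdifferentiableAt, ?_⟩
    ext1 w
    rw [← hθx]
    exact (DFunLike.congr_fun h.mfderiv w).trans (add_zero _)
  exact ⟨y, fun x => (hderiv x).1, fun x => (hderiv x).2⟩

theorem IsPrimitive.contMDiff {y : M → R3} (hy : IsPrimitive θ y) (hθ : IsSmoothForm θ) :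
    ContMDiff (𝓡 2) 𝓘(ℝ, R3) ∞ y := by
  intro p
  have hderiv (z : R2) (hz : z ∈ (extChartAt (𝓡 2) p).target) :
      HasFDerivAt (y ∘ (extChartAt (𝓡 2) p).symm) (chartForm θ p z) z := by
    rw [← funext hy.2]
    exact hasFDerivAt_comp_extChartAt_symm hz (hy.1 _)
  rw [contMDiffAt_iff_source, ModelWithCorners.range_eq_univ, contMDiffWithinAt_univ,
    contMDiffAt_iff_contDiffAt, contDiffAt_infty]
  intro k
  have hk : ContDiffAt ℝ (k + 1) (y ∘ (extChartAt (𝓡 2) p).symm) (extChartAt (𝓡 2) p p) :=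
    contDiffAt_succ_iff_hasFDerivAt.2 ⟨chartForm θ p,
      ⟨_, extChartAt_target_mem_nhds (I := 𝓡 2) p, hderiv⟩, (hθ p).of_le (by exact_mod_cast le_top)⟩
  exact hk.of_le le_self_add

end Primitives

section Smoothness

instance : Fact (Module.finrank ℝ R2 = 2) :=
  ⟨finrank_euclideanSpace_fin⟩

theorem contDiffAt_hodge {E T F : Type*} [NormedAddCommGroup E] [NormedSpace ℝ E]
    [NormedAddCommGroup T] [NormedSpace ℝ T] [FiniteDimensional ℝ T]
    [Fact (Module.finrank ℝ T = 2)] [NormedAddCommGroup F] [NormedSpace ℝ F] {m : ℕ∞}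
    {g : E → T →L[ℝ] T →L[ℝ] ℝ} {α : E → T →L[ℝ] F} {y : E} (hg : ContDiffAt ℝ m g y)
    (hα : ContDiffAt ℝ m α y) (o : Orientation ℝ T (Fin 2))
    (hdet : gramDet (g y) (posBasis o) ≠ 0) :
    ContDiffAt ℝ m (fun z => hodge (g z) o (α z)) y := by
  have : CompleteSpace T := FiniteDimensional.complete ℝ T
  have hentry (i j : Fin 2) : ContDiffAt ℝ m (fun z => g z (posBasis o i) (posBasis o j)) y :=
    (hg.clm_apply contDiffAt_const).clm_apply contDiffAt_const
  have hgram : ContDiffAt ℝ m (fun z => gramDet (g z) (posBasis o)) y :=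
    ((hentry 0 0).mul (hentry 1 1)).sub ((hentry 0 1).mul (hentry 1 0))
  have hvol : ContDiffAt ℝ m (fun z => volForm (g z) o) y :=
    (ContinuousLinearMap.contDiff (F := T →L[ℝ] T →L[ℝ] ℝ)
      ((1 : ℝ →L[ℝ] ℝ).smulRight _)).contDiffAt.comp y
      ((hgram.abs hdet).sqrt (abs_ne_zero.2 hdet))
  obtain ⟨e, he⟩ := isInvertible_of_gramDet_ne_zero hdet
  have hinv : ContDiffAt ℝ m (fun z => (g z).inverse) y :=
    (he ▸ contDiffAt_map_inverse e : ContDiffAt ℝ m ContinuousLinearMap.inverse (g y)).comp y hg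
  exact (hα.clm_comp (hinv.clm_comp hvol)).neg

variable {M : Type*} [TopologicalSpace M] [ChartedSpace R2 M]

/-- The metric `g` in the chart around `p`. -/
noncomputable def chartMetric
    (g : ∀ q : M, TangentSpace (𝓡 2) q →L[ℝ] TangentSpace (𝓡 2) q →L[ℝ] ℝ) (p : M) (y : R2) :
    R2 →L[ℝ] R2 →L[ℝ] ℝ :=
  pullback (g ((extChartAt (𝓡 2) p).symm y))
    (mfderiv 𝓘(ℝ, R2) (𝓡 2) (extChartAt (𝓡 2) p).symm y)

variable [IsManifold (𝓡 2) ∞ M] {K : Kind}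
  {g : ∀ p : M, TangentSpace (𝓡 2) p →L[ℝ] TangentSpace (𝓡 2) p →L[ℝ] ℝ}
  {o : ∀ p : M, Orientation ℝ (TangentSpace (𝓡 2) p) (Fin 2)} {n : M → R3}

theorem symm_mem_trivializationAt_baseSet {p : M} {y : R2} (hy : y ∈ (extChartAt (𝓡 2) p).target) :
    (extChartAt (𝓡 2) p).symm y ∈
      (trivializationAt R2 (TangentSpace (𝓡 2) : M → Type _) p).baseSet := by
  rw [TangentBundle.trivializationAt_baseSet, ← extChartAt_source (𝓡 2)]
  exact (extChartAt (𝓡 2) p).map_target hy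

theorem symmL_trivializationAt_extChartAt_symm {p : M} {y : R2}
    (hy : y ∈ (extChartAt (𝓡 2) p).target) :
    (trivializationAt R2 (TangentSpace (𝓡 2) : M → Type _) p).symmL ℝ
        ((extChartAt (𝓡 2) p).symm y) =
      mfderiv 𝓘(ℝ, R2) (𝓡 2) (extChartAt (𝓡 2) p).symm y := by
  have hq := (extChartAt (𝓡 2) p).map_target hy
  rw [extChartAt_source] at hq
  rw [TangentBundle.symmL_trivializationAt (I := 𝓡 2) hq, ModelWithCorners.range_eq_univ,
    mfderivWithin_univ, (extChartAt (𝓡 2) p).right_inv hy]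

theorem contMDiffOn_symmL_trivializationAt (p : M) (v : R2) :
    ContMDiffOn (𝓡 2) ((𝓡 2).prod 𝓘(ℝ, R2)) ∞
      (fun q => Bundle.TotalSpace.mk' R2 (E := (TangentSpace (𝓡 2) : M → Type _)) q
        ((trivializationAt R2 (TangentSpace (𝓡 2) : M → Type _) p).symmL ℝ q v))
      (trivializationAt R2 (TangentSpace (𝓡 2) : M → Type _) p).baseSet := by
  rw [Bundle.Trivialization.contMDiffOn_section_baseSet_iff]
  refine (contMDiffOn_const (c := v)).congr fun q hq => ?_
  rw [Bundle.Trivialization.symmL_apply _ hq, Bundle.Trivialization.apply_mk_symm _ hq]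

theorem IsMetric.contDiffAt_chartMetric (hg : IsMetric K g) {p : M} {y : R2}
    (hy : y ∈ (extChartAt (𝓡 2) p).target) : ContDiffAt ℝ ∞ (chartMetric g p) y := by
  refine ContDiffOn.contDiffAt ?_ (extChartAt_target_mem_nhds_of_mem p hy)
  refine contDiffOn_clm_apply.2 fun v => contDiffOn_clm_apply.2 fun w => ?_
  set e := trivializationAt R2 (TangentSpace (𝓡 2) : M → Type _) p
  have hcoord : ContMDiffOn (𝓡 2) 𝓘(ℝ, ℝ) ∞ (fun q => g q (e.symmL ℝ q v) (e.symmL ℝ q w))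
      e.baseSet := fun q hq =>
    (Bundle.contMDiffWithinAt_totalSpace.1 (ContMDiffWithinAt.clm_bundle_apply₂ (F₁ := R2)
      (F₂ := R2) (F₃ := ℝ) (E₃ := Bundle.Trivial M ℝ) (hg.contMDiff.contMDiffOn q hq)
      (contMDiffOn_symmL_trivializationAt p v q hq)
      (contMDiffOn_symmL_trivializationAt p w q hq))).2
  refine (hcoord.comp (contMDiffOn_extChartAt_symm p)
    fun z hz => symm_mem_trivializationAt_baseSet hz).contDiffOn.congr fun z hz => ?_
  rw [Function.comp_apply, symmL_trivializationAt_extChartAt_symm hz]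
  rfl

theorem IsMetric.gramDet_chartMetric_ne_zero (hg : IsMetric K g) {p : M} {y : R2}
    (hy : y ∈ (extChartAt (𝓡 2) p).target) (b : Module.Basis (Fin 2) ℝ R2) :
    gramDet (chartMetric g p y) b ≠ 0 := by
  have h := (hg.signature ((extChartAt (𝓡 2) p).symm y)).gramDet_ne_zero (hg.symm _)
    (b.map ((trivializationAt R2 (TangentSpace (𝓡 2) : M → Type _) p).continuousLinearEquivAt ℝ _
      (symm_mem_trivializationAt_baseSet hy)).symm.toLinearEquiv)
  rw [chartMetric, ← symmL_trivializationAt_extChartAt_symm hy,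
    ← Bundle.Trivialization.symm_continuousLinearEquivAt_eq' _
      (symm_mem_trivializationAt_baseSet hy)]
  exact h

theorem IsOrientation.chartForm_starD_eventuallyEq (ho : IsOrientation o) (hg : IsMetric K g)
    (n : M → R3) (p : M) :
    ∃ o₀ : Orientation ℝ R2 (Fin 2), chartForm (starD g o n) p =ᶠ[𝓝 (extChartAt (𝓡 2) p p)]
      fun y => hodge (chartMetric g p y) o₀ (chartForm (mvfderiv (𝓡 2) n) p y) := by
  obtain ⟨o₀, h₀⟩ := ho p
  refine ⟨o₀, ?_⟩
  filter_upwards [(continuousAt_extChartAt_symm (I := 𝓡 2) p).eventually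
      (by rwa [extChartAt_to_inv (I := 𝓡 2) p]),
    extChartAt_target_mem_nhds (I := 𝓡 2) p] with y hy hyt
  set q := (extChartAt (𝓡 2) p).symm y
  let e := (trivializationAt R2 (TangentSpace (𝓡 2) : M → Type _) p).continuousLinearEquivAt ℝ q
    (symm_mem_trivializationAt_baseSet hyt)
  have he : (e.symm : R2 →L[ℝ] TangentSpace (𝓡 2) q) =
      mfderiv 𝓘(ℝ, R2) (𝓡 2) (extChartAt (𝓡 2) p).symm y :=
    (Bundle.Trivialization.symm_continuousLinearEquivAt_eq' ..).trans
      (symmL_trivializationAt_extChartAt_symm hyt)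
  have hoq : Orientation.map (Fin 2) e.symm.toLinearEquiv o₀ = o q :=
    (Orientation.map (Fin 2) e.toLinearEquiv).symm_apply_eq.2
      (hy (symm_mem_trivializationAt_baseSet hyt)).symm
  obtain ⟨b, hb⟩ := (hg.signature q).exists_isOrthonormalFrame (hg.symm q) (o q)
  have h := hodge_pullback e.symm o₀ hb.isInvertible (mvfderiv (𝓡 2) n q)
  rw [hoq, he] at h
  exact h.symm

end Smoothness

section StarD

variable {M : Type*} [TopologicalSpace M] [ChartedSpace R2 M] [IsManifold (𝓡 2) ∞ M] {K : Kind}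
  {g : ∀ p : M, TangentSpace (𝓡 2) p →L[ℝ] TangentSpace (𝓡 2) p →L[ℝ] ℝ}
  {o : ∀ p : M, Orientation ℝ (TangentSpace (𝓡 2) p) (Fin 2)} {n : M → R3}

theorem contDiffAt_comp_extChartAt_symm (hn : ContMDiff (𝓡 2) 𝓘(ℝ, R3) ∞ n) {p : M} {y : R2}
    (hy : y ∈ (extChartAt (𝓡 2) p).target) :
    ContDiffAt ℝ ∞ (n ∘ (extChartAt (𝓡 2) p).symm) y :=
  ((hn _).comp y (contMDiffAt_extChartAt_symm hy)).contDiffAt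

theorem isSmoothForm_mvfderiv (hn : ContMDiff (𝓡 2) 𝓘(ℝ, R3) ∞ n) :
    IsSmoothForm (mvfderiv (𝓡 2) n) := fun p => by
  refine ((contDiffAt_comp_extChartAt_symm hn (mem_extChartAt_target p)).fderiv_right
    (m := ∞) (by simp)).congr_of_eventuallyEq ?_
  filter_upwards [extChartAt_target_mem_nhds (I := 𝓡 2) p] with y hy
  exact (hasFDerivAt_comp_extChartAt_symm hy (hn.mdifferentiableAt (by simp))).fderiv.symm

theorem isSmoothForm_starD (ho : IsOrientation o) (hg : IsMetric K g)
    (hn : ContMDiff (𝓡 2) 𝓘(ℝ, R3) ∞ n) : IsSmoothForm (starD g o n) := fun p => by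
  obtain ⟨o₀, h₀⟩ := ho.chartForm_starD_eventuallyEq hg n p
  have hp := mem_extChartAt_target (I := 𝓡 2) p
  exact (contDiffAt_hodge (hg.contDiffAt_chartMetric hp) (isSmoothForm_mvfderiv hn p) o₀
    (hg.gramDet_chartMetric_ne_zero hp _)).congr_of_eventuallyEq h₀

theorem isSmoothForm_crossStarD (ho : IsOrientation o) (hg : IsMetric K g)
    (hn : ContMDiff (𝓡 2) 𝓘(ℝ, R3) ∞ n) : IsSmoothForm (crossStarD K g o n) := fun p =>
  (K.crossL.contDiff.contDiffAt.comp _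
    (contDiffAt_comp_extChartAt_symm hn (mem_extChartAt_target p))).clm_comp
    (isSmoothForm_starD ho hg hn p)

theorem fderiv_chartForm_crossStarD (hn : ContMDiff (𝓡 2) 𝓘(ℝ, R3) ∞ n)
    (hs : IsSmoothForm (starD g o n)) (p : M) (v w : R2) :
    fderiv ℝ (chartForm (crossStarD K g o n) p) (extChartAt (𝓡 2) p p) v w =
      K.cross (n p) (fderiv ℝ (chartForm (starD g o n) p) (extChartAt (𝓡 2) p p) v w) +
        K.cross (chartForm (mvfderiv (𝓡 2) n) p (extChartAt (𝓡 2) p p) v)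
          (chartForm (starD g o n) p (extChartAt (𝓡 2) p p) w) := by
  have hcross := (K.crossL.hasFDerivAt.comp _ (hasFDerivAt_comp_extChartAt_symm
    (mem_extChartAt_target p) (hn.mdifferentiableAt (by simp)))).clm_comp
    ((hs p).differentiableAt (by simp)).hasFDerivAt
  have hderiv : HasFDerivAt (chartForm (crossStarD K g o n) p) _ (extChartAt (𝓡 2) p p) := hcross
  rw [hderiv.fderiv, ← congrArg n (extChartAt_to_inv (I := 𝓡 2) p)]
  rfl

theorem extDerivOne_crossStarD (hg : IsMetric K g) (hn : ContMDiff (𝓡 2) 𝓘(ℝ, R3) ∞ n)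
    (hs : IsSmoothForm (starD g o n)) (p : M) (v w : TangentSpace (𝓡 2) p) :
    extDerivOne (crossStarD K g o n) p v w = K.cross (n p) (extDerivOne (starD g o n) p v w) := by
  let y := extChartAt (𝓡 2) p p
  let q := (extChartAt (𝓡 2) p).symm y
  obtain ⟨b, hb⟩ := (hg.signature q).exists_isOrthonormalFrame (hg.symm q) (o q)
  have hsymm : K.cross (chartForm (mvfderiv (𝓡 2) n) p y v) (chartForm (starD g o n) p y w) =
      K.cross (chartForm (mvfderiv (𝓡 2) n) p y w) (chartForm (starD g o n) p y v) :=
    hb.cross_hodge_symm (mvfderiv (𝓡 2) n q)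
      (mfderiv 𝓘(ℝ, R2) (𝓡 2) (extChartAt (𝓡 2) p).symm y v)
      (mfderiv 𝓘(ℝ, R2) (𝓡 2) (extChartAt (𝓡 2) p).symm y w)
  have hvw := fderiv_chartForm_crossStarD (K := K) hn hs p v w
  rw [hsymm] at hvw
  refine (congrArg₂ (· - ·) hvw (fderiv_chartForm_crossStarD hn hs p w v)).trans ?_
  rw [add_sub_add_right_eq_sub, ← map_sub]
  rfl

theorem exists_isPrimitive_crossStarD [SimplyConnectedSpace M] (ho : IsOrientation o)
    (hg : IsMetric K g) (hn : ContMDiff (𝓡 2) 𝓘(ℝ, R3) ∞ n)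
    (hpar : ∀ p v w, ∃ c : ℝ, extDerivOne (starD g o n) p v w = c • n p) :
    ∃ y, IsPrimitive (crossStarD K g o n) y := by
  refine (isSmoothForm_crossStarD ho hg hn).exists_isPrimitive fun p v w => ?_
  obtain ⟨c, hc⟩ := hpar p v w
  rw [extDerivOne_crossStarD hg hn (isSmoothForm_starD ho hg hn), hc, map_smul, K.cross_self,
    smul_zero]

end StarD

section Immersions

theorem Kind.form_fderiv_symm {K : Kind} {E : Type*} [NormedAddCommGroup E] [NormedSpace ℝ E]
    {X N : E → R3} {y : E} (hX : ContDiffAt ℝ 2 X y) (hN : DifferentiableAt ℝ N y)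
    (horth : ∀ᶠ z in 𝓝 y, ∀ v, K.form (N z) (fderiv ℝ X z v) = 0) (v w : E) :
    K.form (fderiv ℝ X y v) (fderiv ℝ N y w) = K.form (fderiv ℝ X y w) (fderiv ℝ N y v) := by
  have hX' : HasFDerivAt (fderiv ℝ X) (fderiv ℝ (fderiv ℝ X) y) y :=
    ((hX.fderiv_right (m := 1) (by norm_cast)).differentiableAt (by simp)).hasFDerivAt
  have hproduct (v w : E) :
      K.form (N y) (fderiv ℝ (fderiv ℝ X) y w v) +
        K.form (fderiv ℝ N y w) (fderiv ℝ X y v) = 0 := by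
    have hderiv := K.form.hasFDerivAt_of_bilinear hN.hasFDerivAt
      ((ContinuousLinearMap.apply ℝ R3 v).hasFDerivAt.comp y hX')
    have hzero := (hasFDerivAt_const (𝕜 := ℝ) (0 : ℝ) y).congr_of_eventuallyEq
      (horth.mono fun z hz => hz v)
    exact DFunLike.congr_fun (hderiv.unique hzero) w
  have hsymm : IsSymmSndFDerivAt ℝ X y := hX.isSymmSndFDerivAt (by simp)
  rw [K.form_comm, K.form_comm (fderiv ℝ X y w)]
  linear_combination hproduct v w - hproduct w v - congrArg (K.form (N y)) (hsymm w v)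

variable {M : Type*} [TopologicalSpace M] [ChartedSpace R2 M] {K : Kind}
  {x n : M → R3}

theorem mvfderiv_const_smul {p : M} (hx : MDifferentiableAt (𝓡 2) 𝓘(ℝ, R3) x p) (a : ℝ) :
    mvfderiv (𝓡 2) (a • x) p = a • mvfderiv (𝓡 2) x p := by
  ext1 w
  exact DFunLike.congr_fun (hx.hasMFDerivAt.const_smul a).mfderiv w

theorem form_mvfderiv_self {p : M} (hn : MDifferentiableAt (𝓡 2) 𝓘(ℝ, R3) n p) {c : ℝ}
    (hc : ∀ q, K.form (n q) (n q) = c) (v : TangentSpace (𝓡 2) p) :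
    K.form (n p) (mvfderiv (𝓡 2) n p v) = 0 := by
  have hsq := K.form.hasFDerivAt_of_bilinear (hasFDerivAt_id (n p)) (hasFDerivAt_id (n p))
  have hconst : (fun a => K.form (id a) (id a)) ∘ n = fun _ => c := funext hc
  have hderiv := hsq.hasMFDerivAt.comp p hn.hasMFDerivAt
  rw [hconst] at hderiv
  have hzero : K.form (n p) (mvfderiv (𝓡 2) n p v) + K.form (mvfderiv (𝓡 2) n p v) (n p) = 0 :=
    DFunLike.congr_fun (hasMFDerivAt_unique hderiv (hasMFDerivAt_const c p)) v
  rw [K.form_comm _ (n p)] at hzero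
  linarith

variable [IsManifold (𝓡 2) ∞ M]

theorem form_mvfderiv_symm (hx : ContMDiff (𝓡 2) 𝓘(ℝ, R3) ∞ x)
    (hn : MDifferentiable (𝓡 2) 𝓘(ℝ, R3) n)
    (horth : ∀ p v, K.form (n p) (mvfderiv (𝓡 2) x p v) = 0) (p : M)
    (v w : TangentSpace (𝓡 2) p) :
    K.form (mvfderiv (𝓡 2) x p v) (mvfderiv (𝓡 2) n p w) =
      K.form (mvfderiv (𝓡 2) x p w) (mvfderiv (𝓡 2) n p v) := by
  have hp := mem_extChartAt_target (I := 𝓡 2) p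
  have hX {z : R2} (hz : z ∈ (extChartAt (𝓡 2) p).target) :
      fderiv ℝ (x ∘ (extChartAt (𝓡 2) p).symm) z = chartForm (mvfderiv (𝓡 2) x) p z :=
    (hasFDerivAt_comp_extChartAt_symm hz (hx.mdifferentiableAt (by simp))).fderiv
  have hN := hasFDerivAt_comp_extChartAt_symm hp (hn _)
  have hflat := Kind.form_fderiv_symm (K := K)
    ((contDiffAt_comp_extChartAt_symm hx hp).of_le (by norm_cast)) hN.differentiableAt
    (Filter.mem_of_superset (extChartAt_target_mem_nhds (I := 𝓡 2) p) fun z hz v =>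
      hX hz ▸ horth _ _)
    (mfderiv (𝓡 2) 𝓘(ℝ, R2) (extChartAt (𝓡 2) p) p v)
    (mfderiv (𝓡 2) 𝓘(ℝ, R2) (extChartAt (𝓡 2) p) p w)
  rw [hX hp, hN.fderiv] at hflat
  have hxv (u : TangentSpace (𝓡 2) p) := chartForm_comp_mfderiv_extChartAt (mvfderiv (𝓡 2) x)
    (mem_extChartAt_source (I := 𝓡 2) p) u
  have hnv (u : TangentSpace (𝓡 2) p) := chartForm_comp_mfderiv_extChartAt (mvfderiv (𝓡 2) n)
    (mem_extChartAt_source (I := 𝓡 2) p) u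
  rw [← hxv v, ← hxv w, ← hnv v, ← hnv w]
  exact hflat

end Immersions

section MeanCurvature

variable {M : Type*} [TopologicalSpace M] [ChartedSpace R2 M] {K : Kind}
  {o : ∀ p : M, Orientation ℝ (TangentSpace (𝓡 2) p) (Fin 2)} {H : ℝ} {x n : M → R3}

theorem IsImmersionOfKind.exists_isOrthonormalFrame (hx : IsImmersionOfKind K x) {p : M}
    (o : Orientation ℝ (TangentSpace (𝓡 2) p) (Fin 2)) :
    ∃ b, IsOrthonormalFrame K (firstForm K x p) o b :=
  (hx.signature p).exists_isOrthonormalFrame (fun _ _ => K.form_comm _ _) o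

theorem IsGaussMap.eq_cross_of_isOrthonormalFrame (hn : IsGaussMap K o x n) {p : M}
    {b : Module.Basis (Fin 2) ℝ (TangentSpace (𝓡 2) p)}
    (hb : IsOrthonormalFrame K (firstForm K x p) (o p) b) :
    n p = K.gaussSign • K.cross (mvfderiv (𝓡 2) x p (b 0)) (mvfderiv (𝓡 2) x p (b 1)) :=
  hn.eq_cross p b hb.orientation hb.zero_zero hb.zero_one hb.one_one

theorem IsGaussMap.isConformal (hn : IsGaussMap K o x n) (hx : IsImmersionOfKind K x) (p : M) :
    IsConformal K (firstForm K x p) (o p) (n p) (mvfderiv (𝓡 2) x p) := by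
  obtain ⟨b, hb⟩ := hx.exists_isOrthonormalFrame (o p)
  exact isConformal_of_gauss hb (hn.eq_cross_of_isOrthonormalFrame hb)

theorem IsGaussMap.form_self (hn : IsGaussMap K o x n) (hx : IsImmersionOfKind K x) (p : M) :
    K.form (n p) (n p) = K.normalSign := by
  obtain ⟨b, hb⟩ := hx.exists_isOrthonormalFrame (o p)
  exact form_gauss_self hb (hn.eq_cross_of_isOrthonormalFrame hb)

theorem form_conformalPart_mvfderiv {p : M}
    {b : Module.Basis (Fin 2) ℝ (TangentSpace (𝓡 2) p)}
    (hx : IsConformal K (firstForm K x p) (o p) (n p) (mvfderiv (𝓡 2) x p))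
    (hb : IsOrthonormalFrame K (firstForm K x p) (o p) b) :
    K.form (mvfderiv (𝓡 2) x p (b 0))
        (conformalPart K (firstForm K x p) (o p) (n p) (mvfderiv (𝓡 2) n p) (b 0)) =
      -(2 * meanCurvature K x n p) := by
  have hII (v w : TangentSpace (𝓡 2) p) :
      secondForm K x n p v w = -K.form (mvfderiv (𝓡 2) x p v) (mvfderiv (𝓡 2) n p w) := rfl
  rw [hx.form_conformalPart_zero hb, meanCurvature, hb.trace_inverse_comp, hII, hII]
  ring

theorem isCMC_of_conformalPart_eq (hH : H ≠ 0) (hx : IsImmersionOfKind K x)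
    (hn : ContMDiff (𝓡 2) 𝓘(ℝ, R3) ∞ n) (hunit : ∀ p, K.form (n p) (n p) = K.normalSign)
    (hη : ∀ p, conformalPart K (firstForm K x p) (o p) (n p) (mvfderiv (𝓡 2) n p) =
      -(2 * H) • mvfderiv (𝓡 2) x p) : IsCMC K o H x n := by
  have hconf {p : M} {b : Module.Basis (Fin 2) ℝ (TangentSpace (𝓡 2) p)}
      (hb : IsOrthonormalFrame K (firstForm K x p) (o p) b) :
      IsConformal K (firstForm K x p) (o p) (n p) (mvfderiv (𝓡 2) x p) := by
    have hη_conf := isConformal_conformalPart hb (hunit p)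
      (form_mvfderiv_self (hn.mdifferentiableAt (by simp)) hunit)
    have hx_eq : mvfderiv (𝓡 2) x p = (-(2 * H))⁻¹ •
        conformalPart K (firstForm K x p) (o p) (n p) (mvfderiv (𝓡 2) n p) := by
      rw [hη, inv_smul_smul₀ (by simpa using hH)]
    exact hx_eq ▸ hη_conf.smul _
  refine ⟨hx, ⟨hn, fun p b ho h00 h01 h11 => ?_⟩, fun p => ?_⟩
  · have hb : IsOrthonormalFrame K (firstForm K x p) (o p) b :=
      ⟨ho, h00, h01, (K.form_comm _ _).trans h01, h11⟩
    exact (hconf hb).eq_gauss hb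
  · obtain ⟨b, hb⟩ := hx.exists_isOrthonormalFrame (o p)
    have h00 : K.form (mvfderiv (𝓡 2) x p (b 0)) (mvfderiv (𝓡 2) x p (b 0)) = 1 := hb.zero_zero
    have hη0 := form_conformalPart_mvfderiv (hconf hb) hb
    rw [hη, smul_apply, map_smul, h00, smul_eq_mul] at hη0
    linarith

variable [IsManifold (𝓡 2) ∞ M]

theorem IsGaussMap.conformalPart_mvfderiv (hn : IsGaussMap K o x n) (hx : IsImmersionOfKind K x)
    (p : M) : conformalPart K (firstForm K x p) (o p) (n p) (mvfderiv (𝓡 2) n p) =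
      -(2 * meanCurvature K x n p) • mvfderiv (𝓡 2) x p := by
  obtain ⟨b, hb⟩ := hx.exists_isOrthonormalFrame (o p)
  have hconf := hn.isConformal hx
  have hunit := hn.form_self hx
  have hnd : MDifferentiable (𝓡 2) 𝓘(ℝ, R3) n := hn.contMDiff.mdifferentiable (by simp)
  set η := conformalPart K (firstForm K x p) (o p) (n p) (mvfderiv (𝓡 2) n p)
  have hη_conf : IsConformal K (firstForm K x p) (o p) (n p) η :=
    isConformal_conformalPart hb (hunit p) (form_mvfderiv_self (hnd p) hunit)
  have hζ := hη_conf.add ((hconf p).smul (2 * meanCurvature K x n p))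
  have h00 : K.form (mvfderiv (𝓡 2) x p (b 0)) (mvfderiv (𝓡 2) x p (b 0)) = 1 := hb.zero_zero
  have h10 : K.form (mvfderiv (𝓡 2) x p (b 1)) (mvfderiv (𝓡 2) x p (b 0)) = 0 := hb.one_zero
  have hη0 := form_conformalPart_mvfderiv (hconf p) hb
  have hη1 := (hconf p).form_conformalPart_one (β := mvfderiv (𝓡 2) n p) hb (hunit p)
  rw [form_mvfderiv_symm hx.contMDiff hnd (fun q => (hconf q).orthogonal), sub_self] at hη1
  rw [neg_smul, ← add_eq_zero_iff_eq_neg]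
  refine hζ.eq_zero hb (Kind.eq_zero_of_orthogonal (hunit p)
    (hn.eq_cross_of_isOrthonormalFrame hb) (hζ.orthogonal _) ?_ ?_)
  · rw [K.form_comm, add_apply, smul_apply, map_add, map_smul, h00, hη0, smul_eq_mul, mul_one,
      neg_add_cancel]
  · rw [K.form_comm, add_apply, smul_apply, map_add, map_smul, h10, hη1, smul_zero, add_zero]

theorem IsCMC.exists_isPrimitive (hH : H ≠ 0) (h : IsCMC K o H x n) :
    ∃ y, IsPrimitive (crossStarD K (firstForm K x) o n) y ∧
      ∀ p, x p = -(1 / (2 * H)) • (n p + y p) := by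
  have hx : MDifferentiable (𝓡 2) 𝓘(ℝ, R3) x := h.immersion.contMDiff.mdifferentiable (by simp)
  have hn : MDifferentiable (𝓡 2) 𝓘(ℝ, R3) n := h.gaussMap.contMDiff.mdifferentiable (by simp)
  have hη (p : M) : mvfderiv (𝓡 2) n p + crossStarD K (firstForm K x) o n p =
      -(2 * H) • mvfderiv (𝓡 2) x p :=
    h.meanCurvature_eq p ▸ h.gaussMap.conformalPart_mvfderiv h.immersion p
  refine ⟨-(2 * H) • x - n, ⟨fun p => ((hx p).const_smul _).sub (hn p), fun p => ?_⟩, fun p => ?_⟩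
  · rw [mvfderiv_sub ((hx p).const_smul _) (hn p), mvfderiv_const_smul (hx p), ← hη,
      add_sub_cancel_left]
  · have hcancel : -(1 / (2 * H)) * -(2 * H) = 1 := by field_simp
    rw [Pi.sub_apply, Pi.smul_apply, add_sub_cancel, smul_smul, hcancel, one_smul]

end MeanCurvature

section ConformalFactor

variable {M : Type*} [TopologicalSpace M] [ChartedSpace R2 M] {K : Kind}
  {g : ∀ p : M, TangentSpace (𝓡 2) p →L[ℝ] TangentSpace (𝓡 2) p →L[ℝ] ℝ}
  {o : ∀ p : M, Orientation ℝ (TangentSpace (𝓡 2) p) (Fin 2)} {n : M → R3}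
  {η : ∀ p : M, TangentSpace (𝓡 2) p →L[ℝ] R3}

theorem IsSmoothForm.add {θ : ∀ q : M, TangentSpace (𝓡 2) q →L[ℝ] R3} (hη : IsSmoothForm η)
    (hθ : IsSmoothForm θ) : IsSmoothForm (fun p => η p + θ p) := fun p =>
  ((hη p).add (hθ p)).congr_of_eventuallyEq
    (.of_forall fun _ => ContinuousLinearMap.add_comp _ _ _)

variable [IsManifold (𝓡 2) ∞ M]

theorem exists_conformalFactor (hg : IsMetric K g)
    (hη : ∀ p, IsConformal K (g p) (o p) (n p) (η p))
    (hunit : ∀ p, K.form (n p) (n p) = K.normalSign) (hnv : K.Nonvanishing η) :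
    ∃ c : M → ℝ, (∀ p, c p ≠ 0) ∧ (∀ p, 0 < c p ∨ K = .timelike) ∧
      ∀ p, pullback K.form (η p) = c p • g p := by
  choose b hb using fun p => (hg.signature p).exists_isOrthonormalFrame (hg.symm p) (o p)
  have hpos (hK : K ≠ .timelike) (hne : ∀ p, η p ≠ 0) (p : M) :=
    (hη p).conformalFactor_pos hK (hb p) (hunit p) (hne p)
  have hfactor (p : M) := (hη p).pullback_form_eq (hb p) (hunit p)
  refine ⟨fun p => K.form (η p (b p 0)) (η p (b p 0)), ?_, ?_, hfactor⟩
  · cases K with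
    | euclidean => exact fun p => (hpos (by simp) hnv p).ne'
    | spacelike => exact fun p => (hpos (by simp) hnv p).ne'
    | timelike => exact fun p => (hη p).conformalFactor_ne_zero (hb p) (hnv p)
  · cases K with
    | euclidean => exact fun p => .inl (hpos (by simp) hnv p)
    | spacelike => exact fun p => .inl (hpos (by simp) hnv p)
    | timelike => exact fun p => .inr rfl

theorem exists_apply_ne_zero_of_gramDet_ne_zero {T : Type*} [AddCommGroup T] [Module ℝ T]
    [TopologicalSpace T] {g : T →L[ℝ] T →L[ℝ] ℝ} {f : Fin 2 → T} (h : gramDet g f ≠ 0) :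
    ∃ v w, g v w ≠ 0 := by
  by_contra! h0
  exact h (by rw [gramDet, h0, h0 (f 0) (f 1), zero_mul, zero_mul, sub_zero])

theorem continuous_conformalFactor (hg : IsMetric K g) (hη : IsSmoothForm η) {c : M → ℝ}
    (hc : ∀ p, pullback K.form (η p) = c p • g p) : Continuous c := by
  refine continuous_iff_continuousAt.2 fun p => ?_
  have hp := mem_extChartAt_target (I := 𝓡 2) p
  obtain ⟨v, w, hvw⟩ := exists_apply_ne_zero_of_gramDet_ne_zero
    (hg.gramDet_chartMetric_ne_zero hp (EuclideanSpace.basisFun (Fin 2) ℝ).toBasis)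
  have hgc : ContinuousAt (fun y => chartMetric g p y v w) (extChartAt (𝓡 2) p p) :=
    ((hg.contDiffAt_chartMetric hp).continuousAt.clm_apply continuousAt_const).clm_apply
      continuousAt_const
  have hηc (u : R2) : ContinuousAt (fun y => chartForm η p y u) (extChartAt (𝓡 2) p p) :=
    (hη p).continuousAt.clm_apply continuousAt_const
  have hquot : ContinuousAt (fun y => K.form (chartForm η p y v) (chartForm η p y w) /
      chartMetric g p y v w) (extChartAt (𝓡 2) p p) :=
    ((K.form.continuous.continuousAt.comp (hηc v)).clm_apply (hηc w)).div hgc hvw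
  refine (hquot.comp (continuousAt_extChartAt (I := 𝓡 2) p)).congr ?_
  filter_upwards [(continuousAt_extChartAt (I := 𝓡 2) p).eventually
    (hgc.eventually_ne hvw), extChartAt_source_mem_nhds (I := 𝓡 2) p] with q hq hqs
  have hchart (y : R2) : K.form (chartForm η p y v) (chartForm η p y w) =
      c ((extChartAt (𝓡 2) p).symm y) * chartMetric g p y v w :=
    DFunLike.congr_fun (DFunLike.congr_fun (hc ((extChartAt (𝓡 2) p).symm y)) _) _
  rw [Function.comp_apply, hchart, mul_div_cancel_right₀ _ hq, (extChartAt (𝓡 2) p).left_inv hqs]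

theorem pos_or_neg_of_continuous {X : Type*} [TopologicalSpace X] [PreconnectedSpace X] {c : X → ℝ}
    (hc : Continuous c) (h0 : ∀ x, c x ≠ 0) : (∀ x, 0 < c x) ∨ ∀ x, c x < 0 := by
  by_contra! h
  obtain ⟨⟨x, hx⟩, y, hy⟩ := h
  obtain ⟨z, hz⟩ := mem_range_of_exists_le_of_exists_ge hc ⟨x, hx⟩ ⟨y, hy⟩
  exact h0 z hz

end ConformalFactor

section Representation

variable {M : Type*} [TopologicalSpace M] [ChartedSpace R2 M] {K : Kind}
  {g : ∀ p : M, TangentSpace (𝓡 2) p →L[ℝ] TangentSpace (𝓡 2) p →L[ℝ] ℝ}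
  {o o' : ∀ p : M, Orientation ℝ (TangentSpace (𝓡 2) p) (Fin 2)} {H : ℝ} {x n : M → R3}

theorem IsImmersionOfKind.of_signature (hx : ContMDiff (𝓡 2) 𝓘(ℝ, R3) ∞ x)
    (hsig : ∀ p, K.HasSignature (firstForm K x p)) : IsImmersionOfKind K x := by
  refine ⟨hx, fun p => (injective_iff_map_eq_zero _).2 fun v hv => ?_, hsig⟩
  have hinv := isInvertible_of_gramDet_ne_zero ((hsig p).gramDet_ne_zero
    (fun _ _ => K.form_comm _ _) (Module.finBasisOfFinrankEq ℝ (TangentSpace (𝓡 2) p) Fact.out))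
  have hker : firstForm K x p v = 0 := by
    ext1 w
    exact (congrArg (fun a => K.form a _) hv).trans (DFunLike.congr_fun (map_zero K.form) _)
  exact hinv.injective (hker.trans (map_zero _).symm)

theorem isCMC_of_rot_eq (hH : H ≠ 0) (hx : IsImmersionOfKind K x)
    (hn : ContMDiff (𝓡 2) 𝓘(ℝ, R3) ∞ n) (hunit : ∀ p, K.form (n p) (n p) = K.normalSign)
    (hdx : ∀ p, mvfderiv (𝓡 2) x p =
      -(1 / (2 * H)) • conformalPart K (g p) (o p) (n p) (mvfderiv (𝓡 2) n p))
    (hrot : ∀ p, rot (firstForm K x p) (o' p) = rot (g p) (o p)) : IsCMC K o' H x n := by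
  refine isCMC_of_conformalPart_eq hH hx hn hunit fun p => ?_
  have hcancel : -(2 * H) * -(1 / (2 * H)) = 1 := by field_simp
  rw [conformalPart_congr (hrot p), hdx, smul_smul, hcancel, one_smul]

theorem mvfderiv_representation (hn : MDifferentiable (𝓡 2) 𝓘(ℝ, R3) n) {y : M → R3}
    (hy : IsPrimitive (crossStarD K g o n) y) (r : ℝ) (p : M) :
    mvfderiv (𝓡 2) (r • (n + y)) p =
      r • conformalPart K (g p) (o p) (n p) (mvfderiv (𝓡 2) n p) := by
  rw [mvfderiv_const_smul ((hn p).add (hy.1 p)), mvfderiv_add (hn p) (hy.1 p), hy.2 p]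
  rfl

variable [IsManifold (𝓡 2) ∞ M]

theorem contMDiff_representation (ho : IsOrientation o) (hg : IsMetric K g)
    (hn : ContMDiff (𝓡 2) 𝓘(ℝ, R3) ∞ n) {y : M → R3} (hy : IsPrimitive (crossStarD K g o n) y)
    (r : ℝ) : ContMDiff (𝓡 2) 𝓘(ℝ, R3) ∞ (r • (n + y)) :=
  ContMDiff.smul (f := fun _ => r) (contMDiff_const (I' := 𝓘(ℝ, ℝ)))
    (hn.add (hy.contMDiff (isSmoothForm_crossStarD ho hg hn)))

theorem isCMC_representation_or_isCMC_neg (ho : IsOrientation o) (hH : H ≠ 0)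
    (hK : K = .timelike → PreconnectedSpace M) (hg : IsMetric K g)
    (hn : ContMDiff (𝓡 2) 𝓘(ℝ, R3) ∞ n) (hunit : ∀ p, K.form (n p) (n p) = K.normalSign)
    (hnv : K.Nonvanishing fun p => mvfderiv (𝓡 2) n p + crossStarD K g o n p) {y : M → R3}
    (hy : IsPrimitive (crossStarD K g o n) y) :
    IsCMC K o H (-(1 / (2 * H)) • (n + y)) n ∨
      (K = .timelike ∧ IsCMC K (fun p => -o p) H (-(1 / (2 * H)) • (n + y)) n) := by
  have hnd : MDifferentiable (𝓡 2) 𝓘(ℝ, R3) n := hn.mdifferentiable (by simp)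
  choose b hb using fun p => (hg.signature p).exists_isOrthonormalFrame (hg.symm p) (o p)
  have hη (p : M) : IsConformal K (g p) (o p) (n p)
      (conformalPart K (g p) (o p) (n p) (mvfderiv (𝓡 2) n p)) :=
    isConformal_conformalPart (hb p) (hunit p) (form_mvfderiv_self (hnd p) hunit)
  obtain ⟨c, hc0, hcK, hc⟩ := exists_conformalFactor hg hη hunit hnv
  have hr : 0 < (-(1 / (2 * H))) ^ 2 := by rw [neg_sq]; positivity
  have hdx := mvfderiv_representation hnd hy (-(1 / (2 * H)))
  have hI (p : M) : firstForm K (-(1 / (2 * H)) • (n + y)) p =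
      ((-(1 / (2 * H))) ^ 2 * c p) • g p := by
    rw [mul_smul, ← hc, ← pullback_smul, ← hdx]
    rfl
  have hx : IsImmersionOfKind K (-(1 / (2 * H)) • (n + y)) :=
    .of_signature (contMDiff_representation ho hg hn hy _) fun p => hI p ▸
      (hg.signature p).smul (mul_ne_zero hr.ne' (hc0 p)) ((hcK p).imp_left (mul_pos hr))
  have hsign : (∀ p, 0 < c p) ∨ (K = .timelike ∧ ∀ p, c p < 0) := by
    by_cases h : K = .timelike
    · have := hK h
      exact (pos_or_neg_of_continuous (continuous_conformalFactor hg ((isSmoothForm_mvfderiv hn).add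
        (isSmoothForm_crossStarD ho hg hn)) hc) hc0).imp_right fun hneg => ⟨h, hneg⟩
    · exact .inl fun p => (hcK p).resolve_right h
  refine hsign.imp (fun hpos => ?_) fun ⟨ht, hneg⟩ => ⟨ht, ?_⟩
  · exact isCMC_of_rot_eq hH hx hn hunit hdx fun p => hI p ▸
      rot_smul_of_pos (hb p).isInvertible (mul_pos hr (hpos p)) (o p)
  · exact isCMC_of_rot_eq hH hx hn hunit hdx fun p => hI p ▸
      rot_smul_neg_of_neg (hb p).isInvertible (mul_neg_of_pos_of_neg hr (hneg p)) (o p)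

end Representation

end Kenmotsu

open Kenmotsu in
theorem corollary2p3_general (K : Kind) (M : Type*) [TopologicalSpace M] [ChartedSpace R2 M]
    [IsManifold (𝓡 2) ∞ M] (o : ∀ p : M, Orientation ℝ (TangentSpace (𝓡 2) p) (Fin 2))
    (ho : IsOrientation o) (H : ℝ) (hH : H ≠ 0) :
    (∀ x n : M → R3, IsCMC K o H x n →
      ∃ y : M → R3, IsPrimitive (crossStarD K (firstForm K x) o n) y ∧
        ∀ p, x p = -(1 / (2 * H)) • (n p + y p)) ∧
    ∀ g : (∀ p : M, TangentSpace (𝓡 2) p →L[ℝ] TangentSpace (𝓡 2) p →L[ℝ] ℝ), IsMetric K g →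
    ∀ n : M → R3, ContMDiff (𝓡 2) 𝓘(ℝ, R3) ∞ n →
      (SimplyConnectedSpace M →
        (∀ p v w, ∃ c : ℝ, extDerivOne (starD g o n) p v w = c • n p) →
        ∃ y : M → R3, IsPrimitive (crossStarD K g o n) y) ∧
      ((K = Kind.timelike → PreconnectedSpace M) →
        (∀ p, K.form (n p) (n p) = K.normalSign) →
        K.Nonvanishing (fun p => mvfderiv (𝓡 2) n p + crossStarD K g o n p) →
        ∀ y : M → R3, IsPrimitive (crossStarD K g o n) y →
          IsCMC K o H (fun p => -(1 / (2 * H)) • (n p + y p)) n ∨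
          (K = Kind.timelike ∧
            IsCMC K (fun p => -o p) H (fun p => -(1 / (2 * H)) • (n p + y p)) n)) :=
  ⟨fun _ _ h => h.exists_isPrimitive hH, fun _ hg _ hn =>
    ⟨fun _ hpar => exists_isPrimitive_crossStarD ho hg hn hpar, fun hK hunit hnv _ hy =>
      isCMC_representation_or_isCMC_neg ho hH hK hg hn hunit hnv hy⟩⟩

open Kenmotsu in
theorem corollary2p3 (K : Kind) (M : Type*) [TopologicalSpace M] [T2Space M]
    [SecondCountableTopology M] [ChartedSpace R2 M] [IsManifold (𝓡 2) ∞ M]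
    (o : ∀ p : M, Orientation ℝ (TangentSpace (𝓡 2) p) (Fin 2)) (ho : IsOrientation o)
    (H : ℝ) (hH : H ≠ 0) :
    (ConnectedSpace M → ∀ x n : M → R3, IsCMC K o H x n →
      ∃ y : M → R3, IsPrimitive (crossStarD K (firstForm K x) o n) y ∧
        ∀ p, x p = -(1 / (2 * H)) • (n p + y p)) ∧
    (SimplyConnectedSpace M →
      ∀ g : (∀ p : M, TangentSpace (𝓡 2) p →L[ℝ] TangentSpace (𝓡 2) p →L[ℝ] ℝ),
      IsMetric K g →
      ∀ n : M → R3, ContMDiff (𝓡 2) 𝓘(ℝ, R3) ∞ n →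
      (∀ p, K.form (n p) (n p) = K.normalSign) →
      (∀ p v w, ∃ c : ℝ, extDerivOne (starD g o n) p v w = c • n p) →
      K.Nonvanishing (fun p => mvfderiv (𝓡 2) n p + crossStarD K g o n p) →
      (∃ y : M → R3, IsPrimitive (crossStarD K g o n) y) ∧
      ∀ y : M → R3, IsPrimitive (crossStarD K g o n) y →
        IsCMC K o H (fun p => -(1 / (2 * H)) • (n p + y p)) n ∨
        (K = Kind.timelike ∧
          IsCMC K (fun p => -o p) H (fun p => -(1 / (2 * H)) • (n p + y p)) n)) := by
  obtain ⟨ha, hb⟩ := corollary2p3_general K M o ho H hH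
  exact ⟨fun _ => ha, fun hM g hg n hn hunit hpar hnv =>
    ⟨(hb g hg n hn).1 hM hpar, (hb g hg n hn).2 (fun _ => inferInstance) hunit hnv⟩⟩
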